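/- Let $V$ be a finite set of $N\ge 2$ vertices with distinguished vertices $s\ne t$. An input graph is a directed graph on $V$ without loops or multiple edges. A switching network for directed connectivity on $V$ is a finite undirected multigraph $G'$ with distinguished vertices $s',t'$, each edge of which is labelled $v\to w$ or $\neg(v\to w)$ with $v,w\in V$; its size is its number of vertices. It is monotone if it has no labels $\neg(v\to w)$. It accepts an input graph $G$ if there is a path from $s'$ to $t'$ in $G'$ all of whose labels are $e$ for an edge $e$ of $G$ or $\neg e$ for a non-edge $e$ of $G$. It is sound (complete) if it accepts only (all) input graphs with a path from $s$ to $t$. It solves a non-empty set $I$ of input graphs if it accepts those members of $I$ that contain a path from $s$ to $t$ and no other member of $I$, and moreover is sound if all members of $I$ contain such a path, and is complete if none does. For a set $K$ of edges on $V$ let $\bar K$ be the set of all $v\to w$, $v\neq w$, such that $K$ contains a path from $v$ to $w$, if $K$ contains no path from $s$ to $t$, and the set of all $v\to w$ with $v\ne w$ otherwise. Write $K_1\preceq K_2$ if $\bar K_1\subseteq\bar K_2$, and $K_1\equiv K_2$ if $\bar K_1=\bar K_2$. A certain-knowledge switching network is a monotone switching network to whose vertices $v'$ one can assign edge sets $K_{v'}$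 such that $K_{s'}\equiv\emptyset$, $K_{t'}\equiv\{s\to t\}$ and, for every edge of $G'$ with ends $v_1',v_2'$ and label $v\to w$, $K_{v_2'}\preceq K_{v_1'}\cup\{v\to w\}$ and $K_{v_1'}\preceq K_{v_2'}\cup\{v\to w\}$. Let $M(I)$ (respectively $C(I)$) be the smallest size of a monotone (respectively certain-knowledge) switching network solving $I$. A family $(I_N)_{N\ge2}$, where $I_N$ is a set of input graphs on $N$ vertices, is easy for monotone (certain-knowledge) switching networks if there is a polynomial $p$ with $M(I_N)\le p(N)$ (respectively $C(I_N)\le p(N)$) for all $N$, and hard otherwise. For $k\ge0$ let $P$ be the path $w_0\to w_1\to\dots\to w_{k+1}$. An augmented path of length $k+1$ on $V$ is an input graph obtained as follows: partition $V$ into $\{s,t\},V_0,L,R$, choose a bijection $\phi:V_0\cup\{s,t\}\to\{w_0,\dots,w_{k+1}\}$ with $\phi(s)=w_0$, $\phi(t)=w_{k+1}$, and take the edges $s\to v$ for $v\in L$, $v\to t$ for $v\in R$, and $v\to w$ whenever $\phi(v)\to\phi(w)$ is an edge of $P$. Theorem. Every family that is easy for certain-knowledge switching networks is easy for monotone switching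 networks, but the converse fails: there are functions $k:\mathbb N\to\mathbb N$ with $k(N)+2\le N$ for all $N\ge2$ and $k(N)=2^{\Theta(\sqrt{\lg N})}$ as $N\to\infty$ (i.e. $\lg k(N)=\Theta(\sqrt{\lg N})$), and for every such $k$ the family $(I_N)$, where $I_N$ is the set of all augmented paths of length $k(N)+1$ on $N$ vertices, consists of non-empty sets, is easy for monotone switching networks and is hard for certain-knowledge switching networks; moreover, $C(I_N)$ is finite for all $N$, and for every polynomial $p$ we have $C(I_N)>p(N)$ for all sufficiently large $N$. -/

import Mathlib

open Filter Asymptotics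
open scoped Polynomial

namespace SwitchingNet

/-- A directed graph with vertex set `V`, without loops and without multiple edges. -/
@[ext]
structure InputGraph (V : Type*) extends Digraph V where
  loopless : ∀ v, ¬ Adj v v

/-- `G` contains a path from `v` to `w`. -/
def InputGraph.HasPath {V : Type*} (G : InputGraph V) (v w : V) : Prop :=
  Relation.ReflTransGen G.Adj v w

/-- Labels of edges of a switching network: `pos v w` is `v → w`, `neg v w` is `¬(v → w)`. -/
inductive Label (V : Type*) where
  | pos (v w : V)
  | neg (v w : V)

/-- A label is consistent with an input graph `G` if it is `e` for an edge `e` of `G`, or `¬e` for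
a non-edge `e` of `G`. -/
def Label.Consistent {V : Type*} (G : InputGraph V) : Label V → Prop
  | .pos v w => G.Adj v w
  | .neg v w => ¬ G.Adj v w

/-- A switching network for directed connectivity on the vertex set `V`: a finite undirected
multigraph with distinguished vertices `src` (`s'`) and `snk` (`t'`), whose edges carry labels. -/
structure Network (V : Type*) where
  Node : Type
  Edge : Type
  graph : Graph Node Edge
  finite_vertexSet : graph.vertexSet.Finite
  finite_edgeSet : graph.edgeSet.Finite
  src : Node
  snk : Node
  src_mem : src ∈ graph.vertexSet
  snk_mem : snk ∈ graph.vertexSet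
  label : Edge → Label V

namespace Network

variable {V : Type*}

/-- The size of a switching network is its number of vertices. -/
noncomputable def size (W : Network V) : ℕ := W.graph.vertexSet.ncard

/-- There are no negated labels. -/
def IsMonotone (W : Network V) : Prop :=
  ∀ e ∈ W.graph.edgeSet, ∃ v w, W.label e = .pos v w

/-- `W` has a path from `s'` to `t'` all of whose edges are consistent with `G`. -/
def Accepts (W : Network V) (G : InputGraph V) : Prop :=
  Relation.ReflTransGen
    (fun x y => ∃ e, W.graph.IsLink e x y ∧ (W.label e).Consistent G) W.src W.snk

/-- `W` accepts no input graph without a path from `s` to `t`. -/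
def Sound (W : Network V) (s t : V) : Prop :=
  ∀ G : InputGraph V, ¬ G.HasPath s t → ¬ W.Accepts G

/-- `W` accepts every input graph with a path from `s` to `t`. -/
def Complete (W : Network V) (s t : V) : Prop :=
  ∀ G : InputGraph V, G.HasPath s t → W.Accepts G

/-- `W` solves the (non-empty) set `I` of inputs: it accepts the members of `I` which have a path
from `s` to `t` and no other member of `I`; moreover, if all members of `I` have such a path then
`W` is required to be sound, and if none has then `W` is required to be complete. -/
def Solves (W : Network V) (s t : V) (I : Set (InputGraph V)) : Prop :=
  (∀ G ∈ I, G.HasPath s t → W.Accepts G) ∧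
  (∀ G ∈ I, ¬ G.HasPath s t → ¬ W.Accepts G) ∧
  ((∀ G ∈ I, G.HasPath s t) → W.Sound s t) ∧
  ((∀ G ∈ I, ¬ G.HasPath s t) → W.Complete s t)

end Network

/-- A knowledge set, represented by its set of edges. (Loops play no role: they never enter the
transitive closure below.) -/
abbrev KnowledgeSet (V : Type*) := Set (V × V)

namespace KnowledgeSet

variable {V : Type*}

/-- There is a path from `v` to `w` in `K`. -/
def HasPath (K : KnowledgeSet V) (v w : V) : Prop :=
  Relation.ReflTransGen (fun a b => (a, b) ∈ K) v w

/-- The transitive closure of `K`: if `K` has no path from `s` to `t`, the set of all `v → w`,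
`v ≠ w`, such that `K` has a path from `v` to `w`; otherwise all `v → w` with `v ≠ w`. -/
def closure (s t : V) (K : KnowledgeSet V) : KnowledgeSet V :=
  {p | p.1 ≠ p.2 ∧ (HasPath K s t ∨ HasPath K p.1 p.2)}

/-- Containment of (classes of) knowledge sets: `K₁ ⊆ K₂` means containment of the closures. -/
def Le (s t : V) (K₁ K₂ : KnowledgeSet V) : Prop := closure s t K₁ ⊆ closure s t K₂

/-- Equality of (classes of) knowledge sets. -/
def Equiv (s t : V) (K₁ K₂ : KnowledgeSet V) : Prop := closure s t K₁ = closure s t K₂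

end KnowledgeSet

namespace Network

variable {V : Type*}

/-- `K` is a valid certain-knowledge description of `W`. -/
def IsValidDescription (W : Network V) (s t : V) (K : W.Node → KnowledgeSet V) : Prop :=
  KnowledgeSet.Equiv s t (K W.src) ∅ ∧ KnowledgeSet.Equiv s t (K W.snk) {(s, t)} ∧
  ∀ e x y v w, W.graph.IsLink e x y → W.label e = .pos v w →
    KnowledgeSet.Le s t (K y) (K x ∪ {(v, w)}) ∧ KnowledgeSet.Le s t (K x) (K y ∪ {(v, w)})

/-- `W` is a certain-knowledge switching network: a monotone switching network which has a valid
certain-knowledge description. -/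
def IsCertainKnowledge (W : Network V) (s t : V) : Prop :=
  W.IsMonotone ∧ ∃ K : W.Node → KnowledgeSet V, W.IsValidDescription s t K

end Network

/-- `M(I)`: the size of the smallest monotone switching network solving `I`
(`⊤` if there were none). -/
noncomputable def monotoneComplexity {V : Type*} (s t : V) (I : Set (InputGraph V)) : ℕ∞ :=
  ⨅ (W : Network V) (_ : W.IsMonotone ∧ W.Solves s t I), (W.size : ℕ∞)

/-- `C(I)`: the size of the smallest certain-knowledge switching network solving `I`
(`⊤` if there were none). -/
noncomputable def certainKnowledgeComplexity {V : Type*} (s t : V) (I : Set (InputGraph V)) :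
    ℕ∞ :=
  ⨅ (W : Network V) (_ : W.IsCertainKnowledge s t ∧ W.Solves s t I), (W.size : ℕ∞)

/-- A family of sets of inputs, one for each number `N = n + 2 ≥ 2` of vertices. The vertex set is
`Fin (n + 2)`, with `s = 0` and `t` the last element. -/
abbrev InputFamily := (n : ℕ) → Set (InputGraph (Fin (n + 2)))

namespace InputFamily

/-- `M(I_N)`, where `N = n + 2`. -/
noncomputable def monotone (I : InputFamily) (n : ℕ) : ℕ∞ :=
  monotoneComplexity 0 (Fin.last (n + 1)) (I n)

/-- `C(I_N)`, where `N = n + 2`. -/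
noncomputable def certainKnowledge (I : InputFamily) (n : ℕ) : ℕ∞ :=
  certainKnowledgeComplexity 0 (Fin.last (n + 1)) (I n)

/-- There is a polynomial `p` with `M(I_N) ≤ p(N)` for all `N`. (Every real polynomial is bounded
on `ℕ` by a polynomial with natural coefficients.) -/
def EasyForMonotone (I : InputFamily) : Prop :=
  ∃ p : ℕ[X], ∀ n, I.monotone n ≤ ((p.eval (n + 2) : ℕ) : ℕ∞)

/-- There is a polynomial `p` with `C(I_N) ≤ p(N)` for all `N`. -/
def EasyForCertainKnowledge (I : InputFamily) : Prop :=
  ∃ p : ℕ[X], ∀ n, I.certainKnowledge n ≤ ((p.eval (n + 2) : ℕ) : ℕ∞)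

/-- Hard means not easy. -/
def HardForCertainKnowledge (I : InputFamily) : Prop := ¬ I.EasyForCertainKnowledge

end InputFamily

/-- Data `(V₀, L, R, φ)` for augmenting a graph on `U` (with distinguished vertices `s₀, t₀`) to a
graph on `V` (with distinguished vertices `s, t`): `{s, t}, V₀, L, R` are disjoint sets with union
`V`, and `φ` is a one-to-one correspondence between `V₀ ∪ {s, t}` and `U` with `φ(s) = s₀` and
`φ(t) = t₀`. -/
structure Augmentation {V U : Type*} (s t : V) (s₀ t₀ : U) where
  V₀ : Set V
  L : Set V
  R : Set V
  disjoint_st_V₀ : Disjoint {s, t} V₀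
  disjoint_st_L : Disjoint {s, t} L
  disjoint_st_R : Disjoint {s, t} R
  disjoint_V₀_L : Disjoint V₀ L
  disjoint_V₀_R : Disjoint V₀ R
  disjoint_L_R : Disjoint L R
  union_eq : V₀ ∪ L ∪ R ∪ {s, t} = Set.univ
  φ : (V₀ ∪ {s, t} : Set V) ≃ U
  map_s : φ ⟨s, by simp⟩ = s₀
  map_t : φ ⟨t, by simp⟩ = t₀

/-- The graph `G(G₀, V₀, L, R, φ)`, with edges `s → v` for `v ∈ L`, `v → t` for `v ∈ R`, and
`v → w` for `v, w ∈ V₀ ∪ {s, t}` such that `φ(v) → φ(w)` is an edge of `G₀`. -/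
def Augmentation.graph {V U : Type*} {s t : V} {s₀ t₀ : U} (A : Augmentation s t s₀ t₀)
    (G₀ : InputGraph U) : InputGraph V where
  Adj v w := (v = s ∧ w ∈ A.L) ∨ (v ∈ A.R ∧ w = t) ∨
    ∃ (hv : v ∈ A.V₀ ∪ {s, t}) (hw : w ∈ A.V₀ ∪ {s, t}), G₀.Adj (A.φ ⟨v, hv⟩) (A.φ ⟨w, hw⟩)
  loopless := by
    rintro v (⟨rfl, h⟩ | ⟨h, rfl⟩ | ⟨_, _, h⟩)
    · exact Set.disjoint_left.1 A.disjoint_st_L (by simp) h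
    · exact Set.disjoint_left.1 A.disjoint_st_R (by simp) h
    · exact G₀.loopless _ h

/-- The path of length `k + 1` from `0` to `k + 1`. -/
def pathInput (k : ℕ) : InputGraph (Fin (k + 2)) where
  Adj i j := (i : ℕ) + 1 = j
  loopless v := by simp

/-- All inputs of the form `G(P, V₀, L, R, φ)`, where `P` is the path of length `k + 1`. -/
def augmentedPaths {V : Type*} (s t : V) (k : ℕ) : Set (InputGraph V) :=
  {G | ∃ A : Augmentation s t (0 : Fin (k + 2)) (Fin.last (k + 1)), G = A.graph (pathInput k)}

/-- The family whose set of inputs on `N` vertices consists of all augmented paths of length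
`k(N) + 1`. -/
def augmentedPathFamily (k : ℕ → ℕ) : InputFamily :=
  fun n => augmentedPaths 0 (Fin.last (n + 1)) (k (n + 2))

/-- `k(N) = 2 ^ Θ(√(lg N))`, and a path with `k(N)` inner vertices fits into `N` vertices. -/
structure IsAdmissible (k : ℕ → ℕ) : Prop where
  isTheta : (fun N : ℕ => Real.logb 2 (k N)) =Θ[atTop] (fun N : ℕ => √(Real.logb 2 N))
  fits : ∀ N, 2 ≤ N → k N + 2 ≤ N

end SwitchingNet

/-! Certain-knowledge networks are monotone networks, so only the separation needs an argument. Both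
bounds concern graphs that all have a path from `s` to `t`; the networks must therefore be sound on
every input graph.

Upper bound. Hash the vertices into `p` buckets so that the path vertices are separated. Every other
vertex `w` of a bucket has an edge `s → w`, which makes it reachable from `s`, or an edge `w → t`,
which makes it unreachable if there is no path from `s` to `t`. So the parity of the number of
reachable ones among them is forced, and the parity of the whole bucket then decides whether its
remaining vertex is reachable. Edges thus become edges of a virtual graph with only `2 * p + 2`
vertices, whose virtual paths are sound in every graph (`VirtualAdj.sound`) and whose path of length
`k + 1` is found by repeated halving with size `O(p) ^ lg k`. Evaluating digit polynomials at the
points of a prime field gives a hash family with `p` polynomial in `k` and `lg N`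
(`exists_injOn_eval_digitPoly`). As `lg k` is of order `√(lg N)`, the total is polynomial in `N`.

Lower bound. Follow the knowledge sets along an accepting walk for an augmented path and keep only
what concerns the path. This is a reversible deduction game on `0 → 1 → ⋯ → k + 1`, where deriving
`0 → k + 1` requires touching about `lg k` inner vertices at some moment: doubling the length costs
one more vertex (`Requires.double`). Hence some node's knowledge set is true for the graph and
touches many path vertices (`IsAugmentedPath.exists_node`). Being true, it also predicts, for each
vertex off the path that it mentions, whether that vertex hangs on `s` or on `t`. For a random path
and random sides, a small set rarely meets many path vertices and a large set rarely predicts all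
the sides, so each node serves few graphs and there must be many nodes (`le_card_of_cover`). -/

namespace SwitchingNet

/-! ### Monotone networks given by labelled symmetric relations -/

section NetworkOfRelation

/-- The monotone network on the finite node type `X` in which `x` and `y` are joined by an edge
labelled `v → w` whenever `r v w x y`. -/
noncomputable def Network.ofRel {V X : Type} [Finite V] [Finite X] (r : V → V → X → X → Prop)
    (hr : ∀ v w x y, r v w x y → r v w y x) (a b : X) : Network V where
  Node := X
  Edge := (V × V) × Sym2 X
  graph :=
    { vertexSet := Set.univ
      IsLink := fun e x y => e.2 = s(x, y) ∧ r e.1.1 e.1.2 x y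
      isLink_symm := fun e _ => ⟨fun x y h => ⟨by rw [h.1, Sym2.eq_swap], hr _ _ _ _ h.2⟩⟩
      eq_or_eq_of_isLink_of_isLink := by
        rintro e x y v w ⟨h1, -⟩ ⟨h2, -⟩
        rw [h1, Sym2.eq_iff] at h2
        rcases h2 with h | h
        · exact Or.inl h.1
        · exact Or.inr h.1
      left_mem_of_isLink := fun _ _ _ _ => Set.mem_univ _ }
  finite_vertexSet := Set.toFinite _
  finite_edgeSet := Set.toFinite _
  src := a
  snk := b
  src_mem := Set.mem_univ _
  snk_mem := Set.mem_univ _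
  label := fun e => .pos e.1.1 e.1.2

variable {V X : Type} [Finite V] [Finite X] (r : V → V → X → X → Prop)
    (hr : ∀ v w x y, r v w x y → r v w y x) (a b : X)

lemma Network.ofRel_isMonotone : (Network.ofRel r hr a b).IsMonotone :=
  fun e _ => ⟨e.1.1, e.1.2, rfl⟩

lemma Network.ofRel_size : (Network.ofRel r hr a b).size = Nat.card X :=
  Set.ncard_univ X

lemma Network.ofRel_accepts (G : InputGraph V) :
    (Network.ofRel r hr a b).Accepts G ↔
      Relation.ReflTransGen (fun x y => ∃ v w, r v w x y ∧ G.Adj v w) a b := by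
  have : (fun x y : X => ∃ v w, r v w x y ∧ G.Adj v w) =
      fun x y => ∃ e, (Network.ofRel r hr a b).graph.IsLink e x y ∧
        ((Network.ofRel r hr a b).label e).Consistent G := by
    ext x y
    constructor
    · rintro ⟨v, w, h1, h2⟩
      exact ⟨((v, w), s(x, y)), ⟨rfl, h1⟩, h2⟩
    · rintro ⟨e, h1, h2⟩
      exact ⟨e.1.1, e.1.2, h1.2, h2⟩
  rw [this]
  rfl

end NetworkOfRelation

/-! ### Series-parallel composition of two-terminal networks -/

section Realizable

/-- The property `f` of input graphs is the conduction condition of a two-terminal monotone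
switching network with at most `S` inner nodes. -/
def Realizable {V : Type} (f : InputGraph V → Prop) (S : ℕ) : Prop :=
  ∃ (I : Type) (_ : Finite I) (r : V → V → Bool ⊕ I → Bool ⊕ I → Prop),
    Nat.card I ≤ S ∧ (∀ v w x y, r v w x y → r v w y x) ∧
    ∀ G, f G ↔ Relation.ReflTransGen (fun x y => ∃ v w, r v w x y ∧ G.Adj v w)
      (Sum.inl false) (Sum.inl true)

variable {V : Type}

/-- A path that starts in `P` and only makes steps preserving `P` ends in `P`. -/
lemma reflTransGen_preserves {α : Type*} {r : α → α → Prop} {a b : α}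
    (h : Relation.ReflTransGen r a b) (P : α → Prop) (hP : ∀ x y, P x → r x y → P y)
    (ha : P a) : P b := by
  induction h with
  | refl => exact ha
  | tail _ h2 ih => exact hP _ _ ih h2

lemma reflTransGen_map {α β : Type*} {r : α → α → Prop} {q : β → β → Prop} (e : α → β) {a b : α}
    (h : Relation.ReflTransGen r a b) (hq : ∀ x y, r x y → q (e x) (e y)) :
    Relation.ReflTransGen q (e a) (e b) := by
  induction h with
  | refl => exact .refl
  | tail _ h2 ih => exact ih.tail (hq _ _ h2)

lemma Realizable.mono {f : InputGraph V → Prop} {S T : ℕ} (h : Realizable f S) (hST : S ≤ T) :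
    Realizable f T := by
  obtain ⟨I, hI, r, h1, h2⟩ := h
  exact ⟨I, hI, r, h1.trans hST, h2⟩

lemma Realizable.congr {f g : InputGraph V → Prop} {S : ℕ} (h : Realizable f S)
    (hfg : ∀ G, g G ↔ f G) : Realizable g S := by
  obtain ⟨I, hI, r, h1, h2, h3⟩ := h
  exact ⟨I, hI, r, h1, h2, fun G => (hfg G).trans (h3 G)⟩

lemma realizable_adj (v w : V) : Realizable (fun G => G.Adj v w) 0 := by
  refine ⟨Empty, inferInstance, fun v' w' _ _ => v' = v ∧ w' = w, by simp, by simp, fun G => ?_⟩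
  constructor
  · intro h
    exact .single ⟨v, w, ⟨rfl, rfl⟩, h⟩
  · intro h
    rcases Relation.ReflTransGen.cases_tail h with h | ⟨c, _, v', w', ⟨h₁, h₂⟩, h⟩
    · simp at h
    · exact h₁ ▸ h₂ ▸ h

lemma realizable_false : Realizable (fun _ : InputGraph V => False) 0 := by
  refine ⟨Empty, inferInstance, fun _ _ _ _ => False, by simp, by simp, fun G => ?_⟩
  simp only [false_iff]
  intro h
  have := reflTransGen_preserves h (fun x => x = Sum.inl false) (by simp) rfl
  simp at this

/-- Parallel connection: the terminals are shared, the inner nodes are disjoint. If neither half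
conducts, a walk never gets to the far terminal, so it can change halves only at the near terminal,
where both halves start afresh. -/
lemma Realizable.or {f g : InputGraph V → Prop} {S T : ℕ} (hf : Realizable f S)
    (hg : Realizable g T) : Realizable (fun G => f G ∨ g G) (S + T) := by
  obtain ⟨I, hI, r, h1, h2, h3⟩ := hf
  obtain ⟨J, hJ, q, k1, k2, k3⟩ := hg
  let e₁ : Bool ⊕ I → Bool ⊕ (I ⊕ J) := Sum.map id Sum.inl
  let e₂ : Bool ⊕ J → Bool ⊕ (I ⊕ J) := Sum.map id Sum.inr
  have i₁ : Function.Injective e₁ := Sum.map_injective.2 ⟨fun _ _ h => h, Sum.inl_injective⟩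
  have i₂ : Function.Injective e₂ := Sum.map_injective.2 ⟨fun _ _ h => h, Sum.inr_injective⟩
  refine ⟨I ⊕ J, inferInstance, fun v w x y => (∃ x' y', e₁ x' = x ∧ e₁ y' = y ∧ r v w x' y') ∨
      (∃ x' y', e₂ x' = x ∧ e₂ y' = y ∧ q v w x' y'), ?_, ?_, ?_⟩
  · rw [Nat.card_sum]; omega
  · rintro v w x y (⟨x', y', rfl, rfl, h⟩ | ⟨x', y', rfl, rfl, h⟩)
    · exact Or.inl ⟨y', x', rfl, rfl, h2 _ _ _ _ h⟩
    · exact Or.inr ⟨y', x', rfl, rfl, k2 _ _ _ _ h⟩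
  · intro G
    constructor
    · rintro (h | h)
      · exact reflTransGen_map e₁ ((h3 G).1 h) fun x y ⟨v, w, h, h'⟩ =>
          ⟨v, w, Or.inl ⟨x, y, rfl, rfl, h⟩, h'⟩
      · exact reflTransGen_map e₂ ((k3 G).1 h) fun x y ⟨v, w, h, h'⟩ =>
          ⟨v, w, Or.inr ⟨x, y, rfl, rfl, h⟩, h'⟩
    · intro h
      change f G ∨ g G
      rw [h3, k3]
      by_contra hcon
      push Not at hcon
      have key := reflTransGen_preserves h (fun z =>
        (∃ x, e₁ x = z ∧ Relation.ReflTransGen (fun x y => ∃ v w, r v w x y ∧ G.Adj v w)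
          (Sum.inl false) x) ∨
        (∃ x, e₂ x = z ∧ Relation.ReflTransGen (fun x y => ∃ v w, q v w x y ∧ G.Adj v w)
          (Sum.inl false) x)) ?_ (Or.inl ⟨Sum.inl false, rfl, .refl⟩)
      · rcases key with ⟨x, hx, hx'⟩ | ⟨x, hx, hx'⟩
        · have : x = Sum.inl true := i₁ hx
          exact hcon.1 (this ▸ hx')
        · have : x = Sum.inl true := i₂ hx
          exact hcon.2 (this ▸ hx')
      · rintro z z' hz ⟨v, w, (⟨x, y, rfl, rfl, hxy⟩ | ⟨x, y, rfl, rfl, hxy⟩), hG⟩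
        · refine Or.inl ⟨y, rfl, ?_⟩
          refine Relation.ReflTransGen.tail ?_ ⟨v, w, hxy, hG⟩
          rcases hz with ⟨x', hx', h'⟩ | ⟨x', hx', h'⟩
          · exact i₁ hx' ▸ h'
          · rcases x' with (_ | _) | x'
            · have : Sum.inl false = x := i₁ hx'
              exact this ▸ .refl
            · exact absurd h' hcon.2
            · rcases x with x | x <;> simp [e₁, e₂] at hx'
        · refine Or.inr ⟨y, rfl, ?_⟩
          refine Relation.ReflTransGen.tail ?_ ⟨v, w, hxy, hG⟩
          rcases hz with ⟨x', hx', h'⟩ | ⟨x', hx', h'⟩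
          · rcases x' with (_ | _) | x'
            · have : Sum.inl false = x := i₂ hx'
              exact this ▸ .refl
            · exact absurd h' hcon.1
            · rcases x with x | x <;> simp [e₁, e₂] at hx'
          · exact i₂ hx' ▸ h'

/-- Series connection: `none` is the new node at which the two networks are glued, whence the `+ 1`.
Edges can be walked in both directions, so the invariant for `g` must count the whole first half as
reached, while the invariant for `f` shows that without `f` the walk never leaves the first half. -/
lemma Realizable.and {f g : InputGraph V → Prop} {S T : ℕ} (hf : Realizable f S)
    (hg : Realizable g T) : Realizable (fun G => f G ∧ g G) (S + T + 1) := by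
  obtain ⟨I, hI, r, h1, h2, h3⟩ := hf
  obtain ⟨J, hJ, q, k1, k2, k3⟩ := hg
  let e₁ : Bool ⊕ I → Bool ⊕ (Option (I ⊕ J)) := Sum.elim
    (fun b => bif b then Sum.inr none else Sum.inl false) (fun i => Sum.inr (some (Sum.inl i)))
  let e₂ : Bool ⊕ J → Bool ⊕ (Option (I ⊕ J)) := Sum.elim
    (fun b => bif b then Sum.inl true else Sum.inr none) (fun i => Sum.inr (some (Sum.inr i)))
  have i₁ : Function.Injective e₁ := by
    rintro ((_ | _) | x) ((_ | _) | y) h <;> simp [e₁] at h <;> simp [h]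
  have i₂ : Function.Injective e₂ := by
    rintro ((_ | _) | x) ((_ | _) | y) h <;> simp [e₂] at h <;> simp [h]
  have i₁₂ : ∀ x y, e₁ x = e₂ y → x = Sum.inl true ∧ y = Sum.inl false := by
    rintro ((_ | _) | x) ((_ | _) | y) h <;> simp_all [e₁, e₂]
  have ht₁ : ∀ x, e₁ x ≠ Sum.inl true := by
    rintro ((_ | _) | x) <;> simp [e₁]
  have hs₁ : e₁ (Sum.inl false) = Sum.inl false := rfl
  have ht₂ : e₂ (Sum.inl true) = Sum.inl true := rfl
  have hm : e₁ (Sum.inl true) = e₂ (Sum.inl false) := rfl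
  clear_value e₁ e₂
  refine ⟨Option (I ⊕ J), inferInstance,
    fun v w x y => (∃ x' y', e₁ x' = x ∧ e₁ y' = y ∧ r v w x' y') ∨
      (∃ x' y', e₂ x' = x ∧ e₂ y' = y ∧ q v w x' y'), ?_, ?_, ?_⟩
  · rw [Finite.card_option, Nat.card_sum]; omega
  · rintro v w x y (⟨x', y', rfl, rfl, h⟩ | ⟨x', y', rfl, rfl, h⟩)
    · exact Or.inl ⟨y', x', rfl, rfl, h2 _ _ _ _ h⟩
    · exact Or.inr ⟨y', x', rfl, rfl, k2 _ _ _ _ h⟩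
  · intro G
    constructor
    · rintro ⟨h, h'⟩
      rw [← hs₁, ← ht₂]
      refine Relation.ReflTransGen.trans (b := e₁ (Sum.inl true)) ?_ ?_
      · exact reflTransGen_map e₁ ((h3 G).1 h) fun x y ⟨v, w, h, h'⟩ =>
          ⟨v, w, Or.inl ⟨x, y, rfl, rfl, h⟩, h'⟩
      · rw [hm]
        exact reflTransGen_map e₂ ((k3 G).1 h') fun x y ⟨v, w, h, h'⟩ =>
          ⟨v, w, Or.inr ⟨x, y, rfl, rfl, h⟩, h'⟩
    · intro h
      change f G ∧ g G
      rw [h3, k3]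
      constructor
      · by_contra hcon
        obtain ⟨x, hx, -⟩ := reflTransGen_preserves h (fun z =>
          (∃ x, e₁ x = z ∧ Relation.ReflTransGen (fun x y => ∃ v w, r v w x y ∧ G.Adj v w)
            (Sum.inl false) x)) (by
          rintro _ z' ⟨x, rfl, hx⟩ ⟨v, w, (⟨x', y, hx', rfl, hxy⟩ | ⟨x', y, hx', rfl, hxy⟩), hG⟩
          · exact ⟨y, rfl, .tail (i₁ hx' ▸ hx) ⟨v, w, hxy, hG⟩⟩
          · exact absurd ((i₁₂ _ _ hx'.symm).1 ▸ hx) hcon) ⟨Sum.inl false, hs₁, .refl⟩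
        exact ht₁ _ hx
      · by_contra hcon
        rcases reflTransGen_preserves h (fun z => (∃ x, e₁ x = z) ∨
          (∃ x, e₂ x = z ∧ Relation.ReflTransGen (fun x y => ∃ v w, q v w x y ∧ G.Adj v w)
            (Sum.inl false) x)) (by
          rintro z z' hz ⟨v, w, (⟨x', y, rfl, rfl, hxy⟩ | ⟨x', y, rfl, rfl, hxy⟩), hG⟩
          · exact Or.inl ⟨y, rfl⟩
          · refine Or.inr ⟨y, rfl, .tail ?_ ⟨v, w, hxy, hG⟩⟩
            rcases hz with ⟨x, hx⟩ | ⟨x, hx, hx'⟩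
            · exact (i₁₂ _ _ hx).2 ▸ .refl
            · exact i₂ hx ▸ hx') (Or.inl ⟨Sum.inl false, hs₁⟩) with ⟨x, hx⟩ | ⟨x, hx, hx'⟩
        · exact ht₁ _ hx
        · exact hcon (i₂ (hx.trans ht₂.symm) ▸ hx')

lemma realizable_exists_mem {ι : Type*} (s : Finset ι) (f : ι → InputGraph V → Prop) (S : ℕ)
    (h : ∀ i ∈ s, Realizable (f i) S) : Realizable (fun G => ∃ i ∈ s, f i G) (s.card * S) := by
  classical
  induction s using Finset.induction_on with
  | empty => exact (realizable_false.mono (by simp)).congr (by simp)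
  | insert a s ha ih =>
    refine (((h a (by simp)).or (ih fun i hi => h i (by simp [hi]))).mono ?_).congr (by simp)
    rw [Finset.card_insert_of_notMem ha]
    exact (by ring : S + s.card * S = (s.card + 1) * S).le

lemma realizable_exists {ι : Type*} [Fintype ι] (f : ι → InputGraph V → Prop) (S : ℕ)
    (h : ∀ i, Realizable (f i) S) : Realizable (fun G => ∃ i, f i G) (Fintype.card ι * S) :=
  (realizable_exists_mem Finset.univ f S fun i _ => h i).congr (by simp)

/-- A realizable property that holds for all members of `I`, each of which has a path from `s` to
`t`, and for no graph without such a path bounds the monotone complexity of `I`. -/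
lemma Realizable.monotoneComplexity_le [Finite V] {f : InputGraph V → Prop} {S : ℕ}
    (h : Realizable f S) {s t : V} {I : Set (InputGraph V)} (hne : I.Nonempty)
    (hI : ∀ G ∈ I, G.HasPath s t) (hcomplete : ∀ G ∈ I, f G)
    (hsound : ∀ G, f G → G.HasPath s t) : monotoneComplexity s t I ≤ ((S + 2 : ℕ) : ℕ∞) := by
  obtain ⟨J, hJ, r, h1, h2, h3⟩ := h
  let W := Network.ofRel r h2 (Sum.inl false) (Sum.inl true)
  have hW : ∀ G, W.Accepts G ↔ f G := fun G => by
    rw [h3]; exact Network.ofRel_accepts r h2 _ _ G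
  have hsol : W.Solves s t I := by
    refine ⟨fun G hG _ => (hW G).2 (hcomplete G hG), fun G hG hn => absurd (hI G hG) hn,
      fun _ G hG hacc => hG (hsound G ((hW G).1 hacc)), fun hn => ?_⟩
    obtain ⟨G, hG⟩ := hne
    exact absurd (hI G hG) (hn G hG)
  have hsize : W.size ≤ S + 2 := by
    rw [Network.ofRel_size, Nat.card_sum, Nat.card_eq_fintype_card (α := Bool), Fintype.card_bool]
    omega
  exact (iInf₂_le W ⟨Network.ofRel_isMonotone _ _ _ _, hsol⟩).trans (by exact_mod_cast hsize)

end Realizable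

end SwitchingNet

namespace SwitchingNet

/-! ### Networks computing forced parities -/

section Parity

variable {V : Type} [Fintype V] [DecidableEq V]

/-- `G` has an edge, and for every vertex `w` of `S` it has one of the edges `s → w` and `w → t`,
which can be chosen so that the number of edges `s → w` chosen has the parity `q`. -/
def ForcedParity (s t : V) (S : Finset V) (q : ZMod 2) (G : InputGraph V) : Prop :=
  (∃ v w, G.Adj v w) ∧ ∃ C ⊆ S, (∀ w ∈ C, G.Adj s w) ∧ (∀ w ∈ S \ C, G.Adj w t) ∧
    (C.card : ZMod 2) = q

omit [Fintype V] in
lemma forcedParity_union {s t : V} {S S' : Finset V} (h : Disjoint S S') (q : ZMod 2)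
    (G : InputGraph V) : ForcedParity s t (S ∪ S') q G ↔
      ∃ q' : ZMod 2, ForcedParity s t S q' G ∧ ForcedParity s t S' (q - q') G := by
  constructor
  · rintro ⟨hG, C, hC, h1, h2, h3⟩
    refine ⟨((C ∩ S).card : ZMod 2), ⟨hG, C ∩ S, Finset.inter_subset_right, ?_, ?_, rfl⟩,
      ⟨hG, C ∩ S', Finset.inter_subset_right, ?_, ?_, ?_⟩⟩
    · exact fun w hw => h1 w (Finset.mem_inter.1 hw).1
    · exact fun w hw => h2 w (by simp at hw ⊢; tauto)
    · exact fun w hw => h1 w (Finset.mem_inter.1 hw).1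
    · exact fun w hw => h2 w (by simp at hw ⊢; tauto)
    · rw [← h3, eq_sub_iff_add_eq, ← Nat.cast_add, ← Finset.card_union_of_disjoint, ←
        Finset.inter_union_distrib_left, Finset.union_comm, Finset.inter_eq_left.2 hC]
      exact (h.mono Finset.inter_subset_right Finset.inter_subset_right).symm
  · rintro ⟨q', ⟨hG, C, hC, h1, h2, h3⟩, ⟨-, D, hD, k1, k2, k3⟩⟩
    refine ⟨hG, C ∪ D, Finset.union_subset_union hC hD, ?_, ?_, ?_⟩
    · intro w hw
      rcases Finset.mem_union.1 hw with hw | hw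
      · exact h1 w hw
      · exact k1 w hw
    · intro w hw
      simp only [Finset.mem_sdiff, Finset.mem_union, not_or] at hw
      rcases hw.1 with h' | h'
      · exact h2 w (by simp [h', hw.2.1])
      · exact k2 w (by simp [h', hw.2.2])
    · rw [Finset.card_union_of_disjoint (h.mono hC hD), Nat.cast_add, h3, k3]
      ring

omit [DecidableEq V] in
-- The constant true property is not realizable, because the terminals are distinct and nothing
-- conducts in the empty graph. For an empty vertex set and parity `0` its place is taken by the
-- existence of an edge, which is why `ForcedParity` includes that condition.
lemma realizable_exists_adj : Realizable (fun G : InputGraph V => ∃ v w, G.Adj v w) 0 :=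
  (realizable_exists _ _ fun v => realizable_exists _ _ fun w => realizable_adj v w).mono (by simp)

/-- Divide and conquer: cut `S` into halves and guess the parity of the first one. From size `x = 4
^ d - 1` this gives `2 * (2 * x + 1)`, which is less than `4 ^ (d + 1)`, so the size is polynomial
in the number of vertices. -/
lemma realizable_forcedParity (s t : V) (d : ℕ) : ∀ (S : Finset V) (q : ZMod 2), S.card ≤ 2 ^ d →
    Realizable (ForcedParity s t S q) (4 ^ d - 1) := by
  induction d with
  | zero =>
    intro S q hS
    have hS' : S = ∅ ∨ ∃ w, S = {w} := by
      rw [← Finset.card_eq_zero, ← Finset.card_eq_one]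
      exact Nat.le_one_iff_eq_zero_or_eq_one.1 (by simpa using hS)
    rcases hS' with rfl | ⟨w, rfl⟩
    · by_cases hq : q = 0
      · refine (realizable_exists_adj).congr fun G => ⟨fun h => h.1, fun h => ⟨h, ∅, ?_⟩⟩
        simp [hq]
      · refine realizable_false.congr fun G => ⟨?_, False.elim⟩
        rintro ⟨-, C, hC, -, -, h⟩
        rw [Finset.subset_empty.1 hC] at h
        exact hq (by simpa using h.symm)
    · by_cases hq : q = 0
      · refine (realizable_adj w t).congr fun G => ⟨?_, fun h => ⟨⟨_, _, h⟩, ∅, ?_⟩⟩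
        · rintro ⟨-, C, hC, h1, h2, h⟩
          rcases Finset.subset_singleton_iff.1 hC with rfl | rfl
          · exact h2 w (by simp)
          · simp [hq] at h
        · simp [hq, h]
      · have hq : q = 1 := by revert q; decide
        refine (realizable_adj s w).congr fun G => ⟨?_, fun h => ⟨⟨_, _, h⟩, {w}, ?_⟩⟩
        · rintro ⟨-, C, hC, h1, h2, h⟩
          rcases Finset.subset_singleton_iff.1 hC with rfl | rfl
          · simp [hq] at h
          · exact h1 w (by simp)
        · simp [hq, h]
  | succ d ih =>
    intro S q hS
    obtain ⟨A, hA, hcard⟩ := Finset.exists_subset_card_eq (s := S) (n := S.card / 2) (by omega)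
    have hB : (S \ A).card ≤ 2 ^ d := by
      rw [Finset.card_sdiff_of_subset hA]; rw [pow_succ] at hS; omega
    have hA' : A.card ≤ 2 ^ d := by rw [pow_succ] at hS; omega
    refine ((realizable_exists (fun (q' : ZMod 2) G => ForcedParity s t A q' G ∧
      ForcedParity s t (S \ A) (q - q') G) _
        fun q' => (ih A q' hA').and (ih (S \ A) (q - q') hB)).mono ?_).congr ?_
    · have : 1 ≤ 4 ^ d := Nat.one_le_pow _ _ (by norm_num)
      rw [ZMod.card, pow_succ]; omega
    · intro G
      rw [← forcedParity_union Finset.disjoint_sdiff, Finset.union_sdiff_of_subset hA]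

end Parity

/-! ### The virtual graph on buckets and reachability by halving -/

section VirtualGraph

variable {V : Type} [Fintype V] [DecidableEq V] {A : Type} [Fintype A]

/-- The virtual edge `a → a'`: some `u ∈ S a` and `u' ∈ S a'` are joined by an edge, and the
parities of the reachable vertices in the rest of `S a` and of `S a'` are known to be `c a` and
`c a'`. -/
def VirtualAdj (s t : V) (S : A → Finset V) (c : A → ZMod 2) (a a' : A) (G : InputGraph V) : Prop :=
  ∃ u ∈ S a, ∃ u' ∈ S a', G.Adj u u' ∧
    (ForcedParity s t ((S a).erase u) (c a) G ∧ ForcedParity s t ((S a').erase u') (c a') G)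

/-- There is a path of length at most `2 ^ j` from `a` to `a'`, by repeated halving. -/
def HalvingReach (E : A → A → InputGraph V → Prop) : ℕ → A → A → InputGraph V → Prop
  | 0, a, a', G => E a a' G
  | j + 1, a, a', G => HalvingReach E j a a' G ∨
      ∃ b, HalvingReach E j a b G ∧ HalvingReach E j b a' G

omit [Fintype V] [DecidableEq V] in
-- With `m` virtual vertices and `x - 1` inner nodes at one level, the next level needs `(x - 1) + m
-- * (2 * x - 1)`, which is at most `(2 * m + 1) * x - 1`.
lemma realizable_halvingReach (E : A → A → InputGraph V → Prop) (S : ℕ)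
    (hE : ∀ a a', Realizable (E a a') S) (j : ℕ) : ∀ a a',
    Realizable (HalvingReach E j a a') ((2 * Fintype.card A + 1) ^ j * (S + 1) - 1) := by
  induction j with
  | zero => intro a a'; exact (hE a a').mono (by simp)
  | succ j ih =>
    intro a a'
    refine ((ih a a').or (realizable_exists _ _ fun b => (ih a b).and (ih b a'))).mono ?_
    set m := Fintype.card A
    set x := (2 * m + 1) ^ j * (S + 1) with hx
    have hx1 : 1 ≤ x := Nat.mul_pos (by positivity) (by omega)
    obtain ⟨y, hy⟩ : ∃ y, x = y + 1 := ⟨x - 1, by omega⟩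
    have : (2 * m + 1) ^ (j + 1) * (S + 1) = (2 * m + 1) * x := by rw [hx]; ring
    rw [this, hy]
    apply Nat.le_sub_of_add_le
    have : y + 1 - 1 = y := rfl
    rw [this]
    nlinarith

omit [Fintype V] [DecidableEq V] [Fintype A] in
lemma HalvingReach.preserves {E : A → A → InputGraph V → Prop} {G : InputGraph V} (P : A → Prop)
    (hP : ∀ a a', E a a' G → P a → P a') (j : ℕ) :
    ∀ a a', HalvingReach E j a a' G → P a → P a' := by
  induction j with
  | zero => exact hP
  | succ j ih =>
    rintro a a' (h | ⟨b, h, h'⟩) ha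
    · exact ih _ _ h ha
    · exact ih _ _ h' (ih _ _ h ha)

omit [Fintype V] [DecidableEq V] [Fintype A] in
lemma halvingReach_of_path {E : A → A → InputGraph V → Prop} {G : InputGraph V} (x : ℕ → A)
    (j : ℕ) : ∀ i l, 1 ≤ l → l ≤ 2 ^ j → (∀ m, i ≤ m → m < i + l → E (x m) (x (m + 1)) G) →
    HalvingReach E j (x i) (x (i + l)) G := by
  induction j with
  | zero =>
    intro i l h1 h2 h
    obtain rfl : l = 1 := by simp at h2; omega
    exact h i le_rfl (by omega)
  | succ j ih =>
    intro i l h1 h2 h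
    by_cases hl : l ≤ 2 ^ j
    · exact Or.inl (ih i l h1 hl h)
    · refine Or.inr ⟨x (i + 2 ^ j), ih i _ Nat.one_le_two_pow le_rfl
        fun m h3 h4 => h m h3 (by omega), ?_⟩
      have := ih (i + 2 ^ j) (l - 2 ^ j) (by omega) (by rw [pow_succ] at h2; omega)
        fun m h3 h4 => h m (by omega) (by omega)
      rwa [show i + 2 ^ j + (l - 2 ^ j) = i + l by omega] at this

omit [Fintype A] in
lemma realizable_virtualAdj (s t : V) (S : A → Finset V) (c : A → ZMod 2) (d : ℕ)
    (hd : Fintype.card V ≤ 2 ^ d) (a a' : A) :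
    Realizable (VirtualAdj s t S c a a') (Fintype.card V * (Fintype.card V * (2 * 4 ^ d))) := by
  have hc : ∀ S : Finset V, S.card ≤ 2 ^ d := fun S => (Finset.card_le_univ S).trans hd
  have := realizable_exists_mem (S a) _ _ fun u _ => realizable_exists_mem (S a') _ _ fun u' _ =>
    (realizable_adj u u').and ((realizable_forcedParity s t d ((S a).erase u) (c a) (hc _)).and
      (realizable_forcedParity s t d ((S a').erase u') (c a') (hc _)))
  refine this.mono ?_
  have h1 : 1 ≤ 4 ^ d := Nat.one_le_pow _ _ (by norm_num)
  gcongr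
  · exact Finset.card_le_univ _
  · exact Finset.card_le_univ _
  · omega

omit [Fintype V] [Fintype A] in
/-- Virtual edges do not leave the set of virtual vertices whose reachable part has the parity
opposite to the prescribed one. -/
lemma VirtualAdj.sound {s t : V} {S : A → Finset V} {c : A → ZMod 2} {G : InputGraph V}
    (hG : ¬ G.HasPath s t) {a a' : A} (h : VirtualAdj s t S c a a' G)
    (x : V → Prop) [DecidablePred x] (hx : ∀ v, x v ↔ G.HasPath s v)
    (ha : (((S a).filter x).card : ZMod 2) = c a + 1) :
    (((S a').filter x).card : ZMod 2) = c a' + 1 := by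
  -- Without a path from `s` to `t` no vertex with an edge to `t` is reachable, so the chosen set
  -- `C` is exactly the reachable part of `T` and the forced parity is the true one.
  have key : ∀ (T : Finset V) (q : ZMod 2), ForcedParity s t T q G →
      ((T.filter x).card : ZMod 2) = q := by
    rintro T q ⟨-, C, hC, h1, h2, h3⟩
    rw [← h3]
    congr 2
    ext w
    simp only [Finset.mem_filter]
    constructor
    · rintro ⟨hw, hxw⟩
      by_contra hwC
      exact hG (((hx w).1 hxw).tail (h2 w (by simp [hw, hwC])))
    · exact fun hw => ⟨hC hw, (hx w).2 (.single (h1 w hw))⟩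
  -- The excluded vertex `u` shifts the parity from `q` to `q + 1` exactly when it is reachable.
  have key2 : ∀ (T : Finset V) (u : V), u ∈ T → ∀ q, ForcedParity s t (T.erase u) q G →
      (((T.filter x).card : ZMod 2) = q + 1 ↔ x u) := by
    intro T u hu q hq
    have := key _ _ hq
    rw [Finset.filter_erase] at this
    by_cases hxu : x u
    · simp only [hxu, iff_true]
      have hmem : u ∈ T.filter x := by simp [hu, hxu]
      rw [← Finset.card_erase_add_one hmem, Nat.cast_add, this, Nat.cast_one]
    · simp only [hxu, iff_false]
      rw [Finset.erase_eq_of_notMem (by simp [hxu])] at this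
      rw [this]
      simp
  obtain ⟨u, hu, u', hu', hadj, h1, h2⟩ := h
  rw [key2 _ u' hu' _ h2, hx]
  exact ((hx u).1 ((key2 _ u hu _ h1).1 ha)).tail hadj

end VirtualGraph

/-! ### Augmented paths as vertex sequences with a set of sides -/

section AugmentedPaths

variable {V : Type*}

/-- Working form of the definition: the inverse of `φ` becomes an injective sequence `g`, and `L`
may be any set, since only its part off the range of `g` matters; `R` is the remainder. -/
lemma mem_augmentedPaths_iff {s t : V} (k : ℕ) (G : InputGraph V) :
    G ∈ augmentedPaths s t k ↔ ∃ g : Fin (k + 2) → V, Function.Injective g ∧ g 0 = s ∧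
      g (Fin.last (k + 1)) = t ∧ ∃ L : Set V, ∀ v w, G.Adj v w ↔
        (v = s ∧ w ∉ Set.range g ∧ w ∈ L) ∨ (v ∉ Set.range g ∧ v ∉ L ∧ w = t) ∨
        ∃ i j : Fin (k + 2), (i : ℕ) + 1 = j ∧ v = g i ∧ w = g j := by
  constructor
  · rintro ⟨A, rfl⟩
    let g : Fin (k + 2) → V := fun i => (A.φ.symm i : V)
    have hr : Set.range g = A.V₀ ∪ {s, t} := by
      ext v
      constructor
      · rintro ⟨i, rfl⟩
        exact (A.φ.symm i).2
      · intro hv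
        exact ⟨A.φ ⟨v, hv⟩, by simp [g]⟩
    refine ⟨g, Subtype.val_injective.comp A.φ.symm.injective, ?_, ?_, A.L, fun v w => ?_⟩
    · simp [g, ← A.map_s]
    · simp [g, ← A.map_t]
    · rw [hr]
      have hL : ∀ w ∈ A.L, w ∉ A.V₀ ∪ {s, t} := by
        rintro w hw (h | h)
        · exact Set.disjoint_left.1 A.disjoint_V₀_L h hw
        · exact Set.disjoint_left.1 A.disjoint_st_L h hw
      have hR : ∀ w, w ∈ A.R ↔ w ∉ A.V₀ ∪ {s, t} ∧ w ∉ A.L := by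
        intro w
        have hu : w ∈ A.V₀ ∪ A.L ∪ A.R ∪ {s, t} := by rw [A.union_eq]; trivial
        constructor
        · intro hw
          refine ⟨?_, fun h => Set.disjoint_left.1 A.disjoint_L_R h hw⟩
          rintro (h | h)
          · exact Set.disjoint_left.1 A.disjoint_V₀_R h hw
          · exact Set.disjoint_left.1 A.disjoint_st_R h hw
        · rintro ⟨h1, h2⟩
          simp only [Set.mem_union] at hu h1
          tauto
      have hpath : (∃ (hv : v ∈ A.V₀ ∪ {s, t}) (hw : w ∈ A.V₀ ∪ {s, t}),
          (pathInput k).Adj (A.φ ⟨v, hv⟩) (A.φ ⟨w, hw⟩)) ↔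
          ∃ i j : Fin (k + 2), (i : ℕ) + 1 = j ∧ v = g i ∧ w = g j := by
        constructor
        · rintro ⟨hv, hw, h⟩
          exact ⟨_, _, h, by simp [g], by simp [g]⟩
        · rintro ⟨i, j, h, rfl, rfl⟩
          refine ⟨(A.φ.symm i).2, (A.φ.symm j).2, ?_⟩
          simp only [g, Subtype.coe_eta, Equiv.apply_symm_apply]
          exact h
      change (_ ∨ _ ∨ _) ↔ _
      rw [hpath, hR]
      have := hL w
      tauto
  · rintro ⟨g, hg, h0, h1, L, hG⟩
    have hst' : ({s, t} : Set V) ⊆ Set.range g := by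
      rintro v (rfl | rfl)
      · exact ⟨0, h0⟩
      · exact ⟨_, h1⟩
    have hr : Set.range g \ {s, t} ∪ {s, t} = Set.range g := Set.sdiff_union_of_subset hst'
    let A : Augmentation s t (0 : Fin (k + 2)) (Fin.last (k + 1)) :=
      { V₀ := Set.range g \ {s, t}
        L := L \ Set.range g
        R := Lᶜ \ Set.range g
        disjoint_st_V₀ := Set.disjoint_sdiff_right
        disjoint_st_L := Set.disjoint_sdiff_right.mono_left hst'
        disjoint_st_R := Set.disjoint_sdiff_right.mono_left hst'
        disjoint_V₀_L := Set.disjoint_sdiff_right.mono_left Set.sdiff_subset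
        disjoint_V₀_R := Set.disjoint_sdiff_right.mono_left Set.sdiff_subset
        disjoint_L_R := (disjoint_compl_right).mono Set.sdiff_subset Set.sdiff_subset
        union_eq := by
          ext v
          have := @hst' v
          simp only [Set.mem_union, Set.mem_sdiff, Set.mem_compl_iff, Set.mem_univ, iff_true]
          generalize (v ∈ ({s, t} : Set V)) = p at this ⊢
          tauto
        φ := (Equiv.setCongr hr).trans (Equiv.ofInjective g hg).symm
        map_s := by
          rw [Equiv.trans_apply, Equiv.symm_apply_eq]
          exact Subtype.ext h0.symm
        map_t := by
          rw [Equiv.trans_apply, Equiv.symm_apply_eq]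
          exact Subtype.ext h1.symm }
    refine ⟨A, ?_⟩
    have hφ : ∀ v (hv : v ∈ A.V₀ ∪ {s, t}), g (A.φ ⟨v, hv⟩) = v := fun v hv =>
      congrArg Subtype.val ((Equiv.ofInjective g hg).apply_symm_apply _)
    have hφ' : ∀ i (hv : g i ∈ A.V₀ ∪ {s, t}), A.φ ⟨g i, hv⟩ = i := fun i hv => hg (hφ _ _)
    ext v w
    rw [hG]
    change _ ↔ (v = s ∧ w ∈ L \ Set.range g) ∨ (v ∈ Lᶜ \ Set.range g ∧ w = t) ∨ _
    have hpath : (∃ (hv : v ∈ A.V₀ ∪ {s, t}) (hw : w ∈ A.V₀ ∪ {s, t}),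
        (pathInput k).Adj (A.φ ⟨v, hv⟩) (A.φ ⟨w, hw⟩)) ↔
        ∃ i j : Fin (k + 2), (i : ℕ) + 1 = j ∧ v = g i ∧ w = g j := by
      constructor
      · rintro ⟨hv, hw, h⟩
        exact ⟨_, _, h, (hφ _ _).symm, (hφ _ _).symm⟩
      · rintro ⟨i, j, h, rfl, rfl⟩
        have hm : ∀ i, g i ∈ A.V₀ ∪ {s, t} := fun i => hr.symm ▸ Set.mem_range_self i
        refine ⟨hm i, hm j, ?_⟩
        rw [hφ', hφ']
        exact h
    rw [hpath]
    simp only [Set.mem_sdiff, Set.mem_compl_iff, and_assoc, and_comm]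

lemma hasPath_of_mem_augmentedPaths {s t : V} {k : ℕ} {G : InputGraph V}
    (h : G ∈ augmentedPaths s t k) : G.HasPath s t := by
  obtain ⟨g, -, rfl, rfl, L, hG⟩ := (mem_augmentedPaths_iff k G).1 h
  have : ∀ i (hi : i < k + 2), G.HasPath (g 0) (g ⟨i, hi⟩) := by
    intro i
    induction i with
    | zero => intro _; exact .refl
    | succ i ih =>
      intro hi
      exact (ih (by omega)).tail ((hG _ _).2 (Or.inr (Or.inr ⟨⟨i, by omega⟩, ⟨i + 1, hi⟩, rfl,
        rfl, rfl⟩)))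
  exact this (k + 1) (by omega)

lemma exists_mem_augmentedPaths {s t : V} {k : ℕ} (g : Fin (k + 2) → V)
    (hg : Function.Injective g) (h0 : g 0 = s) (h1 : g (Fin.last (k + 1)) = t) (L : Set V) :
    ∃ G ∈ augmentedPaths s t k, ∀ v w, G.Adj v w ↔
        (v = s ∧ w ∉ Set.range g ∧ w ∈ L) ∨ (v ∉ Set.range g ∧ v ∉ L ∧ w = t) ∨
        ∃ i j : Fin (k + 2), (i : ℕ) + 1 = j ∧ v = g i ∧ w = g j := by
  let G : InputGraph V :=
    { Adj := fun v w => (v = s ∧ w ∉ Set.range g ∧ w ∈ L) ∨ (v ∉ Set.range g ∧ v ∉ L ∧ w = t) ∨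
        ∃ i j : Fin (k + 2), (i : ℕ) + 1 = j ∧ v = g i ∧ w = g j
      loopless := ?_ }
  · exact ⟨G, (mem_augmentedPaths_iff k G).2 ⟨g, hg, h0, h1, L, fun v w => Iff.rfl⟩,
      fun v w => Iff.rfl⟩
  · rintro v (⟨rfl, h, -⟩ | ⟨h, -, rfl⟩ | ⟨i, j, hij, rfl, h⟩)
    · exact h ⟨0, h0⟩
    · exact h ⟨_, h1⟩
    · rw [hg h] at hij
      omega

/-- The vertex sequence `0, u 0, …, u (k - 1), last`. -/
def pathThrough {n k : ℕ} (u : Fin k → Fin (n + 2)) : Fin (k + 2) → Fin (n + 2) :=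
  Fin.cons 0 (Fin.snoc u (Fin.last (n + 1)) : Fin (k + 1) → Fin (n + 2))

section PathThrough

variable {n k : ℕ} (u : Fin k → Fin (n + 2))

lemma pathThrough_zero : pathThrough u 0 = 0 := rfl

lemma pathThrough_last : pathThrough u (Fin.last (k + 1)) = Fin.last (n + 1) := by
  rw [show Fin.last (k + 1) = (Fin.last k).succ from rfl, pathThrough, Fin.cons_succ, Fin.snoc_last]

lemma pathThrough_inner (j : Fin k) : pathThrough u j.castSucc.succ = u j := by
  rw [pathThrough, Fin.cons_succ, Fin.snoc_castSucc]

lemma pathThrough_injective (hu : Function.Injective u) (h0 : ∀ j, u j ≠ 0)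
    (h1 : ∀ j, u j ≠ Fin.last (n + 1)) : Function.Injective (pathThrough u) := by
  rw [pathThrough, Fin.cons_injective_iff, Fin.snoc_injective_iff]
  refine ⟨?_, hu, ?_⟩
  · rintro ⟨i, hi⟩
    induction i using Fin.lastCases with
    | last => simp [Fin.ext_iff] at hi
    | cast i => exact h0 i (by simpa using hi)
  · rintro ⟨i, hi⟩
    exact h1 i hi

end PathThrough

lemma augmentedPathFamily_nonempty {k : ℕ → ℕ} (hk : IsAdmissible k) (n : ℕ) :
    (augmentedPathFamily k n).Nonempty := by
  have hfit := hk.fits (n + 2) (by omega)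
  let u : Fin (k (n + 2)) → Fin (n + 2) := fun i => ⟨i + 1, by omega⟩
  obtain ⟨G, hG, -⟩ := exists_mem_augmentedPaths (pathThrough u)
    (pathThrough_injective u (fun i j h => by simpa [u, Fin.ext_iff] using h)
      (fun j => by simp [u, Fin.ext_iff]) (fun j => by simp [u, Fin.ext_iff]; omega))
    (pathThrough_zero u) (pathThrough_last u) ∅
  exact ⟨G, hG⟩

end AugmentedPaths

end SwitchingNet

namespace SwitchingNet

/-! ### A small hash family from polynomials over a prime field -/

section Hashing

/-- The polynomial over `ZMod p` whose first `d` coefficients are the digits of `u` in base `p`. -/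
noncomputable def digitPoly (p d u : ℕ) : (ZMod p)[X] :=
  ∑ i ∈ Finset.range d, Polynomial.C ((u / p ^ i : ℕ) : ZMod p) * Polynomial.X ^ i

lemma digitPoly_coeff {p d u i : ℕ} (hi : i < d) :
    (digitPoly p d u).coeff i = ((u / p ^ i : ℕ) : ZMod p) := by
  simp [digitPoly, Polynomial.coeff_X_pow, hi]

lemma digitPoly_coeff_of_le {p d u i : ℕ} (hi : d ≤ i) : (digitPoly p d u).coeff i = 0 := by
  simp [digitPoly, Polynomial.coeff_X_pow, hi]

lemma eq_of_digits_modEq {p : ℕ} (d : ℕ) : ∀ u v : ℕ, u < p ^ d → v < p ^ d →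
    (∀ i < d, u / p ^ i ≡ v / p ^ i [MOD p]) → u = v := by
  induction d with
  | zero => intro u v hu hv _; simp at hu hv; omega
  | succ d ih =>
    intro u v hu hv h
    have h0 : u % p = v % p := by simpa [Nat.ModEq] using h 0 (by omega)
    have h1 : u / p = v / p := by
      refine ih _ _ ?_ ?_ fun i hi => ?_
      · exact Nat.div_lt_of_lt_mul (by rwa [pow_succ'] at hu)
      · exact Nat.div_lt_of_lt_mul (by rwa [pow_succ'] at hv)
      · have := h (i + 1) (by omega)
        rwa [pow_succ', ← Nat.div_div_eq_div_mul, ← Nat.div_div_eq_div_mul] at this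
    rw [← Nat.div_add_mod u p, ← Nat.div_add_mod v p, h0, h1]

/-- Evaluation of digit polynomials at a suitable point of `ZMod p` is injective on a given small
set of numbers. -/
lemma exists_injOn_eval_digitPoly {p d : ℕ} [Fact p.Prime] (U : Finset ℕ)
    (hU : ∀ u ∈ U, u < p ^ d) (hp : U.card * U.card * d < p) :
    ∃ α : ZMod p, Set.InjOn (fun u => (digitPoly p d u).eval α) U := by
  by_contra hcon
  simp only [not_exists, Set.InjOn] at hcon
  push Not at hcon
  -- A point that fails to be injective is a root of the nonzero difference of two digit
  -- polynomials. There are fewer than `U.card ^ 2` ordered pairs and at most `d` roots for each, so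
  -- `p` is too large for all points to fail.
  have hcover : (Finset.univ : Finset (ZMod p)) ⊆ U.offDiag.biUnion fun q =>
      (digitPoly p d q.1 - digitPoly p d q.2).roots.toFinset := by
    intro α _
    obtain ⟨u, hu, v, hv, h, huv⟩ := hcon α
    refine Finset.mem_biUnion.2 ⟨(u, v), Finset.mem_offDiag.2 ⟨hu, hv, huv⟩, ?_⟩
    rw [Multiset.mem_toFinset, Polynomial.mem_roots', Polynomial.IsRoot, Polynomial.eval_sub, h,
      sub_self]
    refine ⟨fun h0 => huv (eq_of_digits_modEq d u v (hU u hu) (hU v hv) fun i hi => ?_), rfl⟩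
    rw [← ZMod.natCast_eq_natCast_iff, ← digitPoly_coeff hi, ← digitPoly_coeff hi,
      sub_eq_zero.1 h0]
  have hroots : ∀ q ∈ U.offDiag,
      (digitPoly p d q.1 - digitPoly p d q.2).roots.toFinset.card ≤ d := by
    intro q _
    by_cases h0 : digitPoly p d q.1 - digitPoly p d q.2 = 0
    · simp [h0]
    refine (Multiset.toFinset_card_le _).trans ((Polynomial.card_roots' _).trans ?_)
    refine Polynomial.natDegree_le_iff_coeff_eq_zero.2 fun i hi => ?_
    rw [Polynomial.coeff_sub, digitPoly_coeff_of_le hi.le, digitPoly_coeff_of_le hi.le, sub_self]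
  have h1 := (Finset.card_le_card hcover).trans (Finset.card_biUnion_le_card_mul _ _ _ hroots)
  rw [Finset.card_univ, ZMod.card, Finset.offDiag_card] at h1
  have : (U.card * U.card - U.card) * d ≤ U.card * U.card * d := by gcongr; omega
  omega

end Hashing

/-! ### The monotone network for augmented paths -/

section UpperBound

/-- The sets of vertices that the virtual vertices stand for: `s`, `t`, and for every value of the
hash function `h` the bucket of the other vertices with this value (once for each parity). -/
def bucket {V B : Type} [Fintype V] [DecidableEq V] [DecidableEq B] (s t : V) (h : V → B) :
    Bool ⊕ B × ZMod 2 → Finset V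
  | .inl false => {s}
  | .inl true => {t}
  | .inr b => Finset.univ.filter fun w => w ≠ s ∧ w ≠ t ∧ h w = b.1

/-- The parities that go with the buckets. -/
def bucketParity {B : Type} : Bool ⊕ B × ZMod 2 → ZMod 2
  | .inl _ => 0
  | .inr b => b.2

variable {V B : Type} [Fintype V] [DecidableEq V] [DecidableEq B] [Fintype B] {s t : V}

omit [Fintype B] in
-- Invariant, if there is no path from `s` to `t`: the reachable part of the bucket has parity
-- opposite to the prescribed one. It holds at `s`, since `{s}` has one reachable vertex and
-- prescribed parity `0`, and fails at `t`.
lemma halvingReach_sound (h : V → B) {G : InputGraph V} {j : ℕ}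
    (hG : HalvingReach (VirtualAdj s t (bucket s t h) bucketParity) j (.inl false) (.inl true) G) :
    G.HasPath s t := by
  classical
  by_contra hst
  have := HalvingReach.preserves (E := VirtualAdj s t (bucket s t h) bucketParity) (fun a => (((bucket s t h a).filter (fun v => G.HasPath s v)).card : ZMod 2) =
    bucketParity a + 1) (fun a a' haa' ha => VirtualAdj.sound hst haa' _ (fun _ => Iff.rfl) ha) _ _ _ hG ?_
  · simp [bucket, bucketParity, Finset.filter_singleton, hst] at this
  · have : G.HasPath s s := .refl
    simp [bucket, bucketParity, Finset.filter_singleton, this]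

omit [Fintype B] in
-- Each inner path vertex is alone on the path within its bucket, so the rest of the bucket hangs on
-- `s` or `t`. Prescribing the parity of its members in `L` turns every path edge into a virtual
-- edge.
lemma halvingReach_complete (h : V → B) {G : InputGraph V} {j k : ℕ} (hk : k + 1 ≤ 2 ^ j)
    (g : Fin (k + 2) → V) (hg0 : g 0 = s) (hg1 : g (Fin.last (k + 1)) = t)
    (hg : Function.Injective g)
    (hh : ∀ i i', h (g i) = h (g i') → i = i') (L : Set V) (hG : ∀ v w, G.Adj v w ↔
        (v = s ∧ w ∉ Set.range g ∧ w ∈ L) ∨ (v ∉ Set.range g ∧ v ∉ L ∧ w = t) ∨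
        ∃ i j : Fin (k + 2), (i : ℕ) + 1 = j ∧ v = g i ∧ w = g j) :
    HalvingReach (VirtualAdj s t (bucket s t h) bucketParity) j (.inl false) (.inl true) G := by
  classical
  let g' : ℕ → V := fun i => g (Fin.ofNat (k + 2) i)
  have hadj : ∀ m, m < k + 1 → G.Adj (g' m) (g' (m + 1)) := by
    intro m hm
    refine (hG _ _).2 (Or.inr (Or.inr ⟨_, _, ?_, rfl, rfl⟩))
    rw [Fin.val_ofNat, Fin.val_ofNat, Nat.mod_eq_of_lt (by omega), Nat.mod_eq_of_lt (by omega)]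
  have hinj : ∀ m m', m < k + 2 → m' < k + 2 → g' m = g' m' → m = m' := by
    intro m m' hm hm' h
    have := hg h
    rwa [Fin.ext_iff, Fin.val_ofNat, Fin.val_ofNat, Nat.mod_eq_of_lt hm, Nat.mod_eq_of_lt hm'] at this
  have h0 : g' 0 = s := hg0
  have h1 : g' (k + 1) = t := by
    refine (congrArg g ?_).trans hg1
    rw [Fin.ext_iff, Fin.val_ofNat, Nat.mod_eq_of_lt (by omega), Fin.val_last]
  let y : ℕ → B × ZMod 2 := fun m => (h (g' m),
    (((Finset.univ.filter fun w => w ≠ s ∧ w ≠ t ∧ h w = h (g' m)).erase (g' m)).filter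
      (fun w => w ∈ L)).card)
  let x : ℕ → Bool ⊕ B × ZMod 2 := fun m => if m = 0 then .inl false else
    if m = k + 1 then .inl true else .inr (y m)
  have hmem : ∀ m, m < k + 2 → g' m ∈ bucket s t h (x m) := by
    intro m hm
    by_cases hm0 : m = 0
    · simp [x, hm0, bucket, h0]
    by_cases hm1 : m = k + 1
    · simp [x, hm1, bucket, h1]
    · have e0 : g' m ≠ s := fun e => hm0 (hinj _ _ hm (by omega) (e.trans h0.symm))
      have e1 : g' m ≠ t := fun e => hm1 (hinj _ _ hm (by omega) (e.trans h1.symm))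
      simp [x, y, hm0, hm1, bucket, e0, e1]
  have hpar : ∀ m, m < k + 2 →
      ForcedParity s t ((bucket s t h (x m)).erase (g' m)) (bucketParity (x m)) G := by
    intro m hm
    refine ⟨⟨_, _, hadj 0 (by omega)⟩, ?_⟩
    by_cases hm0 : m = 0
    · simp [x, hm0, bucket, bucketParity, h0]
    by_cases hm1 : m = k + 1
    · simp [x, hm1, bucket, bucketParity, h1]
    · have hx : x m = .inr (y m) := by simp only [x, hm0, hm1, if_false]
      rw [hx]
      have hr : ∀ w ∈ (Finset.univ.filter fun w => w ≠ s ∧ w ≠ t ∧ h w = h (g' m)).erase (g' m),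
          w ∉ Set.range g := by
        rintro w hw ⟨i, rfl⟩
        simp only [Finset.mem_erase, Finset.mem_filter] at hw
        exact hw.1 (congrArg g (hh _ _ hw.2.2.2.2))
      refine ⟨_, Finset.filter_subset (fun w => w ∈ L) _, ?_, ?_, rfl⟩
      · intro w hw
        rw [Finset.mem_filter] at hw
        exact (hG _ _).2 (Or.inl ⟨rfl, hr w hw.1, hw.2⟩)
      · intro w hw
        rw [Finset.mem_sdiff, Finset.mem_filter] at hw
        exact (hG _ _).2 (Or.inr (Or.inl ⟨hr w hw.1, fun hL => hw.2 ⟨hw.1, hL⟩, rfl⟩))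
  have := halvingReach_of_path (E := VirtualAdj s t (bucket s t h) bucketParity) (G := G) x j 0
    (k + 1) (by omega) hk fun m _ hm => ⟨_, hmem m (by omega), _, hmem (m + 1) (by omega),
      hadj m (by omega), hpar m (by omega), hpar (m + 1) (by omega)⟩
  simpa [x] using this

/-- Upper bound for the monotone complexity of the augmented paths. -/
lemma monotoneComplexity_augmentedPaths_le {n k p d d' j : ℕ} (hp : p.Prime)
    (hd : n + 2 ≤ p ^ d) (hpk : (k + 2) * (k + 2) * d < p) (hd' : n + 2 ≤ 2 ^ d')
    (hj : k + 1 ≤ 2 ^ j)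
    (hne : (augmentedPaths (0 : Fin (n + 2)) (Fin.last (n + 1)) k).Nonempty) :
    monotoneComplexity 0 (Fin.last (n + 1)) (augmentedPaths (0 : Fin (n + 2)) (Fin.last (n + 1)) k)
      ≤ ((p * ((4 * p + 5) ^ j * ((n + 2) * ((n + 2) * (2 * 4 ^ d')) + 1) - 1) + 2 : ℕ) : ℕ∞) := by
  have : Fact p.Prime := ⟨hp⟩
  let h : ZMod p → Fin (n + 2) → ZMod p := fun α u => (digitPoly p d u).eval α
  have hreal := realizable_exists (fun α : ZMod p => HalvingReach
      (VirtualAdj 0 (Fin.last (n + 1)) (bucket 0 (Fin.last (n + 1)) (h α)) bucketParity) j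
        (Sum.inl false) (Sum.inl true)) _ fun α => realizable_halvingReach _ _
          (fun a a' => realizable_virtualAdj 0 (Fin.last (n + 1)) _ _ d' (by rwa [Fintype.card_fin]) a a')
          j (Sum.inl false) (Sum.inl true)
  refine (hreal.monotoneComplexity_le hne (fun G hG => hasPath_of_mem_augmentedPaths hG)
    (fun G hG => ?_) ?_).trans ?_
  · obtain ⟨g, hg, hg0, hg1, L, hL⟩ := (mem_augmentedPaths_iff k G).1 hG
    have hcard : (Finset.univ.image fun i => (g i : ℕ)).card = k + 2 :=
      (Finset.card_image_of_injective _ (f := fun i => (g i : ℕ))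
        (Fin.val_injective.comp hg)).trans (by simp)
    obtain ⟨α, hα⟩ := exists_injOn_eval_digitPoly (p := p) (d := d)
      (Finset.univ.image fun i => (g i : ℕ)) (by
        intro u hu
        obtain ⟨i, -, rfl⟩ := Finset.mem_image.1 hu
        exact (g i).2.trans_le hd) (by rwa [hcard])
    refine ⟨α, halvingReach_complete (h α) hj g hg0 hg1 hg (fun i i' hii' => hg (Fin.ext ?_)) L hL⟩
    exact hα (by simp) (by simp) hii'
  · rintro G ⟨α, hα⟩
    exact halvingReach_sound (h α) hα
  -- The virtual vertices are the two ends and `p` buckets with two parities each.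
  · have e : 2 * (2 + p * 2) + 1 = 4 * p + 5 := by ring
    simp only [Fintype.card_sum, Fintype.card_prod, ZMod.card, Fintype.card_fin,
      Fintype.card_bool, e]
    exact le_rfl

end UpperBound

end SwitchingNet

namespace SwitchingNet

/-! ### Deduction between knowledge sets -/

namespace KnowledgeSet

variable {V : Type*} {s t : V} {K K' : KnowledgeSet V}

lemma HasPath.mono {v w : V} (h : HasPath K v w) (hK : K ⊆ K') : HasPath K' v w :=
  Relation.ReflTransGen.mono (fun _ _ h => hK h) _ _ h

lemma HasPath.of_forall {v w : V} (h : HasPath K v w)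
    (hK : ∀ a b, (a, b) ∈ K → HasPath K' a b) : HasPath K' v w := by
  induction h with
  | refl => exact .refl
  | tail _ h2 ih => exact ih.trans (hK _ _ h2)

lemma HasPath.or_of_forall {v w : V} (h : HasPath K v w)
    (hK : ∀ a b, (a, b) ∈ K → HasPath K' s t ∨ HasPath K' a b) :
    HasPath K' s t ∨ HasPath K' v w := by
  by_cases hst : HasPath K' s t
  · exact Or.inl hst
  · exact Or.inr (h.of_forall fun a b hab => (hK a b hab).resolve_left hst)

lemma le_iff : Le s t K K' ↔ ∀ a b, (a, b) ∈ K → HasPath K' s t ∨ HasPath K' a b := by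
  constructor
  · intro h a b hab
    by_cases hne : a = b
    · exact Or.inr (hne ▸ .refl)
    · exact (h (show (a, b) ∈ closure s t K from ⟨hne, Or.inr (.single hab)⟩)).2
  · rintro h ⟨a, b⟩ ⟨hne, hab | hab⟩
    · exact ⟨hne, Or.inl ((hab.or_of_forall h).elim id id)⟩
    · exact ⟨hne, hab.or_of_forall h⟩

lemma le_of_subset (h : K ⊆ K') : Le s t K K' :=
  le_iff.2 fun _ _ hab => Or.inr (.single (h hab))

lemma Le.hasPath {v w : V} (h : Le s t K K') (hK : HasPath K v w) :
    HasPath K' s t ∨ HasPath K' v w :=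
  hK.or_of_forall (le_iff.1 h)

lemma not_hasPath_empty {v w : V} (hvw : v ≠ w) : ¬ HasPath (∅ : KnowledgeSet V) v w := by
  intro h
  rcases Relation.ReflTransGen.cases_head h with h | ⟨c, h, -⟩
  · exact hvw h
  · exact h

end KnowledgeSet

open KnowledgeSet

/-! ### Soundness and universality of certain-knowledge networks -/

section CertainKnowledge

/-- The knowledge set of all edges of an input graph. -/
def InputGraph.edges {V : Type*} (G : InputGraph V) : KnowledgeSet V := {p | G.Adj p.1 p.2}

/-- Along a walk whose labels are edges of `G`, all knowledge remains deducible from the edges of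
`G`. At the sink this yields `s → t`. -/
lemma Network.IsCertainKnowledge.sound {V : Type*} {s t : V} {W : Network V}
    (h : W.IsCertainKnowledge s t) : W.Sound s t := by
  intro G hG hacc
  obtain ⟨hmono, K, h0, h1, hK⟩ := h
  have key : ∀ y, Relation.ReflTransGen
      (fun x y => ∃ e, W.graph.IsLink e x y ∧ (W.label e).Consistent G) W.src y →
      Le s t (K y) G.edges := by
    intro y hy
    induction hy with
    | refl =>
      refine subset_trans (le_of_eq h0) (le_of_subset (Set.empty_subset _))
    | @tail b c _ h2 ih =>
      obtain ⟨e, he, hcons⟩ := h2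
      obtain ⟨v, w, hvw⟩ := hmono e he.edge_mem
      rw [hvw] at hcons
      refine subset_trans (hK e b c v w he hvw).1 (le_iff.2 ?_)
      rintro a b (hab | hab)
      · exact le_iff.1 ih a b hab
      · have hab : (a, b) = (v, w) := hab
        have hcons : (v, w) ∈ G.edges := hcons
        exact Or.inr (.single (hab ▸ hcons))
  have h2 : Le s t {(s, t)} G.edges := subset_trans (le_of_eq h1.symm) (key _ hacc)
  exact hG ((le_iff.1 h2 s t rfl).elim id id)

/-- Every nonempty set of inputs is solved by a certain-knowledge network. -/
lemma certainKnowledgeComplexity_ne_top {V : Type} [Finite V] {s t : V} (hst : s ≠ t)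
    (I : Set (InputGraph V)) : certainKnowledgeComplexity s t I ≠ ⊤ := by
  classical
  let r : V → V → KnowledgeSet V → KnowledgeSet V → Prop := fun v w K K' =>
    Le s t K' (K ∪ {(v, w)}) ∧ Le s t K (K' ∪ {(v, w)})
  -- The universal network: all knowledge sets are nodes and all legal moves are edges.
  let W := Network.ofRel r (fun v w x y h => ⟨h.2, h.1⟩) ∅ {(s, t)}
  have hW : W.IsCertainKnowledge s t := by
    refine ⟨Network.ofRel_isMonotone _ _ _ _, id, rfl, rfl, ?_⟩
    rintro ⟨⟨v', w'⟩, z⟩ x y v w ⟨-, h⟩ hl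
    simp only [W, Network.ofRel, Label.pos.injEq] at hl
    rw [hl.1, hl.2] at h
    exact h
  have hcomplete : W.Complete s t := by
    intro G hG
    refine (Network.ofRel_accepts r _ _ _ G).2 ?_
    have hsets : ∀ E : Set (V × V), E.Finite → E ⊆ G.edges →
        Relation.ReflTransGen (fun x y => ∃ v w, r v w x y ∧ G.Adj v w) ∅ E := by
      intro E hE
      induction E, hE using Set.Finite.induction_on with
      | empty => exact fun _ => .refl
      | @insert a E _ _ ih =>
        intro h
        refine (ih ((Set.subset_insert _ _).trans h)).tail ⟨a.1, a.2, ⟨?_, ?_⟩,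
          h (Set.mem_insert _ _)⟩
        · exact le_of_subset (by rw [Set.union_singleton])
        · exact le_of_subset ((Set.subset_insert _ _).trans Set.subset_union_left)
    have hG' : HasPath G.edges s t := hG
    obtain ⟨c, hc⟩ : ∃ c, G.Adj s c := by
      rcases Relation.ReflTransGen.cases_head hG with h | ⟨c, h, -⟩
      · exact absurd h hst
      · exact ⟨c, h⟩
    -- Once all edges of `G` are collected there is a path from `s` to `t`, so the set is equivalent
    -- to the sink. The move still needs a label that is an edge of `G`; any one will do.
    refine (hsets G.edges (Set.toFinite _) subset_rfl).tail ⟨s, c, ⟨le_iff.2 ?_, le_iff.2 ?_⟩, hc⟩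
    · exact fun _ _ _ => Or.inl (hG'.mono Set.subset_union_left)
    · exact fun _ _ _ => Or.inl (.single (Or.inl rfl))
  have hsol : W.Solves s t I :=
    ⟨fun G _ hG => hcomplete G hG, fun G _ hG => hW.sound G hG, fun _ => hW.sound,
      fun _ => hcomplete⟩
  exact ne_top_of_le_ne_top (ENat.natCast_ne_top W.size) (iInf₂_le W ⟨hW, hsol⟩)

lemma monotoneComplexity_le_certainKnowledgeComplexity {V : Type*} (s t : V)
    (I : Set (InputGraph V)) : monotoneComplexity s t I ≤ certainKnowledgeComplexity s t I :=
  le_iInf₂ fun W hW => iInf₂_le W ⟨hW.1.1, hW.2⟩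

end CertainKnowledge

end SwitchingNet

namespace SwitchingNet

/-! ### Polynomial size of the monotone network -/

section UpperAsymptotics

lemma IsAdmissible.exists_le_two_pow {k : ℕ → ℕ} (hk : IsAdmissible k) :
    ∃ C : ℕ, ∀ᶠ N : ℕ in atTop, k N ≤ 2 ^ (C * (Nat.sqrt (Nat.clog 2 N) + 1)) := by
  obtain ⟨c, hc⟩ := hk.isTheta.1.bound
  refine ⟨⌈c⌉₊, ?_⟩
  filter_upwards [hc, eventually_ge_atTop 2] with N hN hN2
  rcases Nat.eq_zero_or_pos (k N) with h0 | h0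
  · simp [h0]
  set l := Nat.clog 2 N
  have hN0 : (0 : ℝ) < N := by positivity
  have hx : Real.logb 2 N ≤ l := by
    rw [Real.logb_le_iff_le_rpow (by norm_num) hN0, Real.rpow_natCast]
    exact_mod_cast Nat.le_pow_clog (by norm_num) N
  have hs : √(Real.logb 2 N) ≤ (Nat.sqrt l + 1 : ℕ) := by
    rw [Real.sqrt_le_left (by positivity)]
    refine hx.trans ?_
    exact_mod_cast (Nat.lt_succ_sqrt' l).le
  have hlog : Real.logb 2 (k N) ≤ (⌈c⌉₊ * (Nat.sqrt l + 1) : ℕ) := by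
    refine (le_abs_self _).trans (hN.trans ?_)
    rw [Real.norm_of_nonneg (Real.sqrt_nonneg _), Nat.cast_mul]
    exact mul_le_mul (Nat.le_ceil c) hs (Real.sqrt_nonneg _) (by positivity)
  rw [Real.logb_le_iff_le_rpow (by norm_num) (by exact_mod_cast h0), Real.rpow_natCast] at hlog
  exact_mod_cast hlog

lemma lt_two_pow_sqrt (l : ℕ) : l ≤ 2 ^ (2 * Nat.sqrt l) := by
  have h1 := (Nat.lt_succ_sqrt' l).le
  refine h1.trans ?_
  rw [mul_comm, pow_mul]
  exact Nat.pow_le_pow_left Nat.lt_two_pow_self 2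

/-- For admissible `k` there is `m = O(√(log N))` with `k(N) + 2, log N ≤ 2 ^ m`. -/
lemma IsAdmissible.exists_exponent {k : ℕ → ℕ} (hk : IsAdmissible k) :
    ∃ C : ℕ, ∀ᶠ N : ℕ in atTop, ∃ m, 1 ≤ m ∧ k N + 2 ≤ 2 ^ m ∧ Nat.clog 2 N ≤ 2 ^ m ∧
      m ^ 2 ≤ C * Nat.clog 2 N := by
  obtain ⟨C, hC⟩ := hk.exists_le_two_pow
  refine ⟨(C + 2) ^ 2 * 4, ?_⟩
  filter_upwards [hC, eventually_ge_atTop 2] with N hN hN2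
  set l := Nat.clog 2 N
  have hl : 1 ≤ l := Nat.clog_pos (by norm_num) hN2
  set q := Nat.sqrt l
  have hq : 1 ≤ q := Nat.sqrt_pos.2 hl
  -- The summand `C` pays for `k N`, the summand `2` for `lg N ≤ 2 ^ (2 * q)` and for the additive
  -- `2` in `k N + 2`. Since `q + 1 ≤ 2 * q`, the square of the exponent is at most `4 * (C + 2) ^ 2
  -- * l`.
  refine ⟨(C + 2) * (q + 1), by nlinarith, ?_, ?_, ?_⟩
  · have h1 : 1 ≤ 2 ^ (C * (q + 1)) := Nat.one_le_two_pow
    have h4 : 2 ^ 2 ≤ 2 ^ (2 * (q + 1)) := Nat.pow_le_pow_right (by norm_num) (by omega)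
    rw [add_mul, pow_add]
    nlinarith
  · refine (lt_two_pow_sqrt l).trans (Nat.pow_le_pow_right (by norm_num) ?_)
    change 2 * q ≤ _
    nlinarith
  · have hql : q ^ 2 ≤ l := Nat.sqrt_le' l
    rw [mul_pow, mul_assoc]
    gcongr
    nlinarith

lemma monotoneComplexity_augmentedPaths_le_pow {n k m C : ℕ} (hm : 1 ≤ m) (hkm : k + 2 ≤ 2 ^ m)
    (hlm : Nat.clog 2 (n + 2) ≤ 2 ^ m) (hm2 : m ^ 2 ≤ C * Nat.clog 2 (n + 2))
    (hne : (augmentedPaths (0 : Fin (n + 2)) (Fin.last (n + 1)) k).Nonempty) :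
    monotoneComplexity 0 (Fin.last (n + 1)) (augmentedPaths (0 : Fin (n + 2)) (Fin.last (n + 1)) k)
      ≤ (((n + 2) ^ (2 * (12 * C + 8)) : ℕ) : ℕ∞) := by
  set N := n + 2 with hN
  set l := Nat.clog 2 N with hl
  have hl1 : 1 ≤ l := Nat.clog_pos (by norm_num) (by omega)
  have hNl : N ≤ 2 ^ l := Nat.le_pow_clog (by norm_num) N
  have hlN : 2 ^ l ≤ N ^ 2 := by
    have : 2 ^ (l - 1) < N := Nat.pow_pred_clog_lt_self one_lt_two (by omega : 1 < N)
    have e : 2 ^ l = 2 * 2 ^ (l - 1) := by rw [← pow_succ']; congr 1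
    rw [e, pow_two]
    exact Nat.mul_le_mul (by omega) this.le
  -- Bertrand's postulate. Taking `l` digits is generous: base `2` would already suffice for all
  -- vertices.
  obtain ⟨p, hp, hp1, hp2⟩ := Nat.exists_prime_lt_and_le_two_mul ((k + 2) * (k + 2) * l)
    (by positivity)
  have hNp : N ≤ p ^ l := hNl.trans (Nat.pow_le_pow_left hp.two_le l)
  have hj : k + 1 ≤ 2 ^ m := by omega
  refine (monotoneComplexity_augmentedPaths_le hp hNp hp1 hNl hj hne).trans ?_
  have hp3 : p ≤ 2 ^ (3 * m + 1) := by
    refine hp2.trans ?_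
    calc 2 * ((k + 2) * (k + 2) * l) ≤ 2 * (2 ^ m * 2 ^ m * 2 ^ m) := by gcongr
      _ = 2 ^ (3 * m + 1) := by ring
  have hp4 : 4 * p + 5 ≤ 2 ^ (3 * m + 4) := by
    have h2 : 2 ^ (3 * m + 4) = 8 * 2 ^ (3 * m + 1) := by ring
    have h3 : 2 ^ (1 + 1) ≤ 2 ^ (3 * m + 1) := Nat.pow_le_pow_right (by norm_num) (by omega)
    omega
  have hbig : N * (N * (2 * 4 ^ l)) + 1 ≤ 2 ^ (4 * l + 2) := by
    have h4 : (4 : ℕ) ^ l = 2 ^ (2 * l) := by rw [pow_mul]; rfl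
    have h1 : 1 ≤ 2 ^ (4 * l) := Nat.one_le_two_pow
    calc N * (N * (2 * 4 ^ l)) + 1 ≤ 2 ^ l * (2 ^ l * (2 * 2 ^ (2 * l))) + 2 ^ (4 * l) := by
          rw [h4]; gcongr
      _ = 3 * 2 ^ (4 * l) := by ring
      _ ≤ 4 * 2 ^ (4 * l) := by omega
      _ = 2 ^ (4 * l + 2) := by ring
  -- The only quadratic term in `m` comes from `m` levels of halving with a factor `2 ^ O(m)` each;
  -- it is absorbed by `m ^ 2 ≤ C * l`.
  have hexp : (3 * m + 1) + (3 * m + 4) * m + (4 * l + 2) + 1 ≤ (12 * C + 8) * l := by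
    nlinarith
  have htotal : p * ((4 * p + 5) ^ m * (N * (N * (2 * 4 ^ l)) + 1) - 1) + 2 ≤
      2 ^ ((12 * C + 8) * l) := by
    calc p * ((4 * p + 5) ^ m * (N * (N * (2 * 4 ^ l)) + 1) - 1) + 2
        ≤ p * ((4 * p + 5) ^ m * (N * (N * (2 * 4 ^ l)) + 1)) + 2 := by gcongr; omega
      _ ≤ 2 ^ (3 * m + 1) * ((2 ^ (3 * m + 4)) ^ m * 2 ^ (4 * l + 2)) + 2 := by gcongr
      _ = 2 ^ ((3 * m + 1) + (3 * m + 4) * m + (4 * l + 2)) + 2 := by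
          rw [← pow_mul]; ring
      _ ≤ 2 ^ ((3 * m + 1) + (3 * m + 4) * m + (4 * l + 2)) +
          2 ^ ((3 * m + 1) + (3 * m + 4) * m + (4 * l + 2)) := by
          gcongr
          exact Nat.le_self_pow (by omega) 2
      _ = 2 ^ ((3 * m + 1) + (3 * m + 4) * m + (4 * l + 2) + 1) := by ring
      _ ≤ 2 ^ ((12 * C + 8) * l) := Nat.pow_le_pow_right (by norm_num) hexp
  have : 2 ^ ((12 * C + 8) * l) ≤ N ^ (2 * (12 * C + 8)) := by
    rw [mul_comm, pow_mul, pow_mul]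
    exact Nat.pow_le_pow_left hlN _
  exact_mod_cast htotal.trans this

lemma augmentedPathFamily_easyForMonotone {k : ℕ → ℕ} (hk : IsAdmissible k) :
    (augmentedPathFamily k).EasyForMonotone := by
  obtain ⟨C, hC⟩ := hk.exists_exponent
  obtain ⟨n₀, hn₀⟩ := eventually_atTop.1 hC
  -- The constant term covers the finitely many small cases, where the complexity is finite because
  -- a universal network exists.
  refine ⟨Polynomial.X ^ (2 * (12 * C + 8)) + Polynomial.C
    (∑ i ∈ Finset.range n₀, ((augmentedPathFamily k).monotone i).toNat), fun n => ?_⟩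
  rw [Polynomial.eval_add, Polynomial.eval_pow, Polynomial.eval_X, Polynomial.eval_C]
  rcases le_or_gt n₀ n with h | h
  · obtain ⟨m, h1, h2, h3, h4⟩ := hn₀ (n + 2) (by omega)
    refine (monotoneComplexity_augmentedPaths_le_pow h1 h2 h3 h4
      (augmentedPathFamily_nonempty hk n)).trans ?_
    exact_mod_cast Nat.le_add_right _ _
  · have hfin : (augmentedPathFamily k).monotone n ≠ ⊤ :=
      ne_top_of_le_ne_top (certainKnowledgeComplexity_ne_top (by simp [Fin.ext_iff]) _)
        (monotoneComplexity_le_certainKnowledgeComplexity _ _ _)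
    rw [← ENat.natCast_toNat hfin]
    have := Finset.single_le_sum (f := fun i => ((augmentedPathFamily k).monotone i).toNat)
      (fun _ _ => Nat.zero_le _) (Finset.mem_range.2 h)
    exact_mod_cast this.trans (Nat.le_add_left _ _)

end UpperAsymptotics

/-! ### Existence of admissible path lengths -/

section Admissible

lemma exists_isAdmissible : ∃ k : ℕ → ℕ, IsAdmissible k := by
  -- The value `0` below `16` keeps `k N + 2 ≤ N`; from `16` on, `√(lg N) ≤ lg N - 1` leaves the
  -- necessary room.
  refine ⟨fun N => if N < 16 then 0 else 2 ^ Nat.sqrt (Nat.log 2 N), ?_, fun N hN => ?_⟩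
  · have hlog : ∀ N : ℕ, 16 ≤ N → Real.logb 2 ((if N < 16 then 0 else
        2 ^ Nat.sqrt (Nat.log 2 N) : ℕ) : ℝ) = Nat.sqrt (Nat.log 2 N) := by
      intro N hN
      rw [if_neg (by omega), Nat.cast_pow, Nat.cast_ofNat, ← Real.rpow_natCast,
        Real.logb_rpow (by norm_num) (by norm_num)]
    constructor
    · refine IsBigO.of_bound 1 ?_
      filter_upwards [eventually_ge_atTop 16] with N hN
      rw [hlog N hN, Real.norm_of_nonneg (by positivity), Real.norm_of_nonneg (Real.sqrt_nonneg _),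
        one_mul]
      refine Real.le_sqrt_of_sq_le ?_
      rw [Real.le_logb_iff_rpow_le (by norm_num) (by positivity)]
      have h1 : 2 ^ (Nat.sqrt (Nat.log 2 N) ^ 2) ≤ N :=
        (Nat.pow_le_pow_right (by norm_num) (Nat.sqrt_le' _)).trans
          (Nat.pow_log_le_self 2 (by omega))
      exact_mod_cast h1
    · refine IsBigO.of_bound 2 ?_
      filter_upwards [eventually_ge_atTop 16] with N hN
      rw [hlog N hN, Real.norm_of_nonneg (Real.sqrt_nonneg _), Real.norm_of_nonneg (by positivity),
        Real.sqrt_le_left (by positivity), Real.logb_le_iff_le_rpow (by norm_num) (by positivity)]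
      have hL : 1 ≤ Nat.log 2 N := Nat.log_pos (by norm_num) (by omega)
      have hs : 1 ≤ Nat.sqrt (Nat.log 2 N) := Nat.sqrt_pos.2 hL
      have h2 : Nat.log 2 N + 1 ≤ (2 * Nat.sqrt (Nat.log 2 N)) ^ 2 :=
        (Nat.lt_succ_sqrt' _).trans_le (Nat.pow_le_pow_left (by omega) 2)
      have h3 : N ≤ 2 ^ ((2 * Nat.sqrt (Nat.log 2 N)) ^ 2) :=
        (Nat.lt_pow_succ_log_self (by norm_num) N).le.trans (Nat.pow_le_pow_right (by norm_num) h2)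
      exact_mod_cast h3
  · show (if N < 16 then 0 else 2 ^ Nat.sqrt (Nat.log 2 N)) + 2 ≤ N
    split_ifs with h
    · omega
    · have hL : 4 ≤ Nat.log 2 N := Nat.le_log_of_pow_le (by norm_num) (by omega)
      have hs := Nat.sqrt_le' (Nat.log 2 N)
      have hs1 : Nat.sqrt (Nat.log 2 N) ≤ Nat.log 2 N - 1 := by
        by_contra hcon
        have : Nat.log 2 N ≤ Nat.sqrt (Nat.log 2 N) := by omega
        nlinarith
      have h1 : 2 ^ Nat.sqrt (Nat.log 2 N) ≤ 2 ^ (Nat.log 2 N - 1) :=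
        Nat.pow_le_pow_right (by norm_num) hs1
      have h2 : 2 ^ 1 ≤ 2 ^ (Nat.log 2 N - 1) := Nat.pow_le_pow_right (by norm_num) (by omega)
      have h3 : 2 ^ Nat.log 2 N ≤ N := Nat.pow_log_le_self 2 (by omega)
      have h4 : 2 ^ Nat.log 2 N = 2 * 2 ^ (Nat.log 2 N - 1) := by
        rw [← pow_succ']; congr 1; omega
      omega

end Admissible

end SwitchingNet

namespace SwitchingNet

open KnowledgeSet

/-! ### The reversible deduction game on a path -/

section LineGame

/-- `K` contains only pairs `a ≤ b` with `b ≤ n`. -/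
def Ordered (n : ℕ) (K : KnowledgeSet ℕ) : Prop := ∀ a b, (a, b) ∈ K → a ≤ b ∧ b ≤ n

/-- `K` contains only loops. -/
def OnlyLoops (K : KnowledgeSet ℕ) : Prop := ∀ a b, (a, b) ∈ K → a = b

/-- `K` and `K'` can be deduced from each other with the help of an edge `i → i + 1`. -/
def LineStep (K K' : KnowledgeSet ℕ) : Prop :=
  ∃ i, (∀ a b, (a, b) ∈ K' → HasPath (K ∪ {(i, i + 1)}) a b) ∧
    (∀ a b, (a, b) ∈ K → HasPath (K' ∪ {(i, i + 1)}) a b)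

/-- `v` is an end of an edge of `K` that is not a loop. -/
def Touched (K : KnowledgeSet ℕ) (v : ℕ) : Prop := ∃ w, w ≠ v ∧ ((v, w) ∈ K ∨ (w, v) ∈ K)

open Classical in
/-- The number of vertices between `lo` and `hi` touched by `K`. -/
noncomputable def touchCount (K : KnowledgeSet ℕ) (lo hi : ℕ) : ℕ :=
  ((Finset.Icc lo hi).filter (Touched K)).card

/-- A step of the reversible game on the path `0 → 1 → ⋯ → m + 1` in which only knowledge sets
touching less than `R` inner vertices are allowed. -/
def SmallStep (m R : ℕ) (K K' : KnowledgeSet ℕ) : Prop :=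
  LineStep K K' ∧ (Ordered (m + 1) K ∧ touchCount K 1 m < R) ∧
    (Ordered (m + 1) K' ∧ touchCount K' 1 m < R)

/-- It is impossible to derive `0 → m + 1` from nothing touching less than `R` inner vertices at
all times. -/
def Requires (m R : ℕ) : Prop :=
  ∀ K K', OnlyLoops K → HasPath K' 0 (m + 1) → ¬ Relation.ReflTransGen (SmallStep m R) K K'

variable {K K' : KnowledgeSet ℕ} {m n R : ℕ}

lemma LineStep.symm (h : LineStep K K') : LineStep K' K := by
  obtain ⟨i, h1, h2⟩ := h
  exact ⟨i, h2, h1⟩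

lemma SmallStep.symm (h : SmallStep m R K K') : SmallStep m R K' K := ⟨h.1.symm, h.2.2, h.2.1⟩

lemma OnlyLoops.eq_of_hasPath (h : OnlyLoops K) {a b : ℕ} (hp : HasPath K a b) : a = b := by
  induction hp with
  | refl => rfl
  | tail _ h2 ih => exact ih.trans (h _ _ h2)

lemma touchCount_le_of_imp {lo hi : ℕ} (c : ℕ)
    (h : ∀ v, lo ≤ v → v ≤ hi → Touched K v → Touched K' (v + c)) :
    touchCount K lo hi ≤ touchCount K' (lo + c) (hi + c) := by
  classical
  refine Finset.card_le_card_of_injOn (fun v => v + c) ?_ (fun _ _ _ _ h => by simpa using h)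
  intro v hv
  simp only [Finset.coe_filter, Finset.mem_Icc, Set.mem_ofPred_eq] at hv ⊢
  exact ⟨⟨by omega, by omega⟩, h v hv.1.1 hv.1.2 hv.2⟩

lemma exists_touched_of_touchCount_pos {lo hi : ℕ} (h : 0 < touchCount K lo hi) :
    ∃ v, lo ≤ v ∧ v ≤ hi ∧ Touched K v := by
  classical
  obtain ⟨v, hv⟩ := Finset.card_pos.1 h
  simp only [Finset.mem_filter, Finset.mem_Icc] at hv
  exact ⟨v, hv.1.1, hv.1.2, hv.2⟩

lemma touchCount_add_one_le {lo hi lo' hi' v : ℕ} (hv : Touched K v) (h1 : lo' ≤ v) (h2 : v ≤ hi')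
    (hl : lo' ≤ lo) (hh : hi ≤ hi') (hout : v < lo ∨ hi < v) :
    touchCount K lo hi + 1 ≤ touchCount K lo' hi' := by
  classical
  unfold touchCount
  rw [← Finset.card_insert_of_notMem (a := v) (by
    simp only [Finset.mem_filter, Finset.mem_Icc]; omega)]
  refine Finset.card_le_card ?_
  intro w hw
  simp only [Finset.mem_insert, Finset.mem_filter, Finset.mem_Icc] at hw ⊢
  rcases hw with rfl | hw
  · exact ⟨⟨h1, h2⟩, hv⟩
  · exact ⟨⟨by omega, by omega⟩, hw.2⟩

/-- The image of a knowledge set under a map of the vertices. -/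
def contract (γ : ℕ → ℕ) (K : KnowledgeSet ℕ) : KnowledgeSet ℕ := Prod.map γ γ '' K

lemma mem_contract {γ : ℕ → ℕ} {a b : ℕ} (h : (a, b) ∈ K) : (γ a, γ b) ∈ contract γ K :=
  ⟨(a, b), h, rfl⟩

lemma KnowledgeSet.HasPath.contract (γ : ℕ → ℕ) {a b : ℕ} (h : HasPath K a b) :
    HasPath (SwitchingNet.contract γ K) (γ a) (γ b) :=
  reflTransGen_map γ h fun _ _ h => mem_contract h

/-- A map that raises or keeps the value at each successor sends the edge `i → i + 1` either to an
edge of the same kind or to a loop, which can be dropped. -/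
lemma LineStep.contract {γ : ℕ → ℕ} (hγ : ∀ i, γ (i + 1) = γ i ∨ γ (i + 1) = γ i + 1)
    (h : LineStep K K') : LineStep (contract γ K) (contract γ K') := by
  obtain ⟨i, h1, h2⟩ := h
  have key : ∀ {K : KnowledgeSet ℕ} {a b : ℕ}, HasPath (K ∪ {(i, i + 1)}) a b →
      HasPath (SwitchingNet.contract γ K ∪ {(γ i, γ i + 1)}) (γ a) (γ b) := by
    intro K a b h
    induction h with
    | refl => exact .refl
    | @tail c d _ h2 ih =>
      rcases h2 with h2 | h2
      · exact ih.tail (Or.inl (mem_contract h2))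
      · have h2 : (c, d) = (i, i + 1) := h2
        obtain ⟨rfl, rfl⟩ := Prod.mk.inj h2
        rcases hγ c with h | h
        · rwa [h]
        · exact ih.tail (Or.inr (by rw [h]; rfl))
  refine ⟨γ i, ?_, ?_⟩
  · rintro a b ⟨⟨a', b'⟩, hab, h⟩
    obtain ⟨rfl, rfl⟩ := Prod.mk.inj h
    exact key (h1 _ _ hab)
  · rintro a b ⟨⟨a', b'⟩, hab, h⟩
    obtain ⟨rfl, rfl⟩ := Prod.mk.inj h
    exact key (h2 _ _ hab)

lemma Ordered.contract {γ : ℕ → ℕ} (hγ : Monotone γ) {n' : ℕ} (hn : γ n ≤ n') (h : Ordered n K) :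
    Ordered n' (contract γ K) := by
  rintro a b ⟨⟨a', b'⟩, hab, e⟩
  obtain ⟨rfl, rfl⟩ := Prod.mk.inj e
  exact ⟨hγ (h _ _ hab).1, (hγ (h _ _ hab).2).trans hn⟩

lemma OnlyLoops.contract (γ : ℕ → ℕ) (h : OnlyLoops K) : OnlyLoops (contract γ K) := by
  rintro a b ⟨⟨a', b'⟩, hab, e⟩
  obtain ⟨rfl, rfl⟩ := Prod.mk.inj e
  exact congrArg γ (h _ _ hab)

lemma Touched.of_contract {γ : ℕ → ℕ} {v v' : ℕ} (hv : ∀ a, γ a = v → a = v')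
    (h : Touched (contract γ K) v) : Touched K v' := by
  obtain ⟨w, hw, ⟨⟨a, b⟩, hab, e⟩ | ⟨⟨a, b⟩, hab, e⟩⟩ := h
  · obtain ⟨e1, e2⟩ := Prod.mk.inj e
    refine ⟨b, fun hb => hw ?_, Or.inl (hv a e1 ▸ hab)⟩
    rw [← e1, ← e2]
    exact congrArg γ (hb.trans (hv a e1).symm)
  · obtain ⟨e1, e2⟩ := Prod.mk.inj e
    refine ⟨a, fun hb => hw ?_, Or.inr (hv b e2 ▸ hab)⟩
    rw [← e1, ← e2]
    exact congrArg γ (hb.trans (hv b e2).symm)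

/-- The part of `K` on the vertices up to `M`. -/
def restrict (M : ℕ) (K : KnowledgeSet ℕ) : KnowledgeSet ℕ := {p | p ∈ K ∧ p.2 ≤ M}

/-- Ordered edges never go down, so a deduction of `a → b` with `b ≤ M` uses no vertex above `M`. -/
lemma LineStep.restrict (M : ℕ) (hK : Ordered n K) (hK' : Ordered n K') (h : LineStep K K') :
    LineStep (restrict M K) (restrict M K') := by
  obtain ⟨i, h1, h2⟩ := h
  have key : ∀ {K : KnowledgeSet ℕ} {a b : ℕ}, Ordered n K → HasPath (K ∪ {(i, i + 1)}) a b →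
      b ≤ M → HasPath (SwitchingNet.restrict M K ∪ {(i, i + 1)}) a b := by
    intro K a b hK h
    induction h with
    | refl => exact fun _ => .refl
    | @tail c d _ h2 ih =>
      intro hd
      rcases h2 with h2 | h2
      · exact (ih ((hK _ _ h2).1.trans hd)).tail (Or.inl ⟨h2, hd⟩)
      · have h2' : (c, d) = (i, i + 1) := h2
        obtain ⟨rfl, rfl⟩ := Prod.mk.inj h2'
        exact (ih (by omega)).tail (Or.inr h2)
  exact ⟨i, fun a b hab => key hK (h1 a b hab.1) hab.2, fun a b hab => key hK' (h2 a b hab.1) hab.2⟩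

/-- The mirror image of `K` on the vertices `0, …, n`. -/
def mirror (n : ℕ) (K : KnowledgeSet ℕ) : KnowledgeSet ℕ := (fun p => (n - p.2, n - p.1)) '' K

lemma LineStep.mirror (n : ℕ) (h : LineStep K K') : LineStep (mirror n K) (mirror n K') := by
  obtain ⟨i, h1, h2⟩ := h
  have key : ∀ {K : KnowledgeSet ℕ} {a b : ℕ}, HasPath (K ∪ {(i, i + 1)}) a b →
      HasPath (SwitchingNet.mirror n K ∪ {(n - (i + 1), n - (i + 1) + 1)}) (n - b) (n - a) := by
    intro K a b h
    induction h with
    | refl => exact .refl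
    | @tail c d _ h2 ih =>
      rcases h2 with h2 | h2
      · exact ih.head (Or.inl ⟨_, h2, rfl⟩)
      · have h2 : (c, d) = (i, i + 1) := h2
        obtain ⟨rfl, rfl⟩ := Prod.mk.inj h2
        -- For `c ≥ n` truncated subtraction sends both ends of the edge to `0`, and no step is
        -- needed.
        rcases Nat.lt_or_ge c n with h | h
        · refine ih.head (Or.inr ?_)
          rw [show n - c = n - (c + 1) + 1 by omega]
          rfl
        · rwa [show n - (c + 1) = n - c by omega] at *
  refine ⟨n - (i + 1), ?_, ?_⟩
  · rintro a b ⟨⟨a', b'⟩, hab, h⟩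
    obtain ⟨rfl, rfl⟩ := Prod.mk.inj h
    exact key (h1 _ _ hab)
  · rintro a b ⟨⟨a', b'⟩, hab, h⟩
    obtain ⟨rfl, rfl⟩ := Prod.mk.inj h
    exact key (h2 _ _ hab)

lemma Ordered.mirror (h : Ordered n K) : Ordered n (mirror n K) := by
  rintro a b ⟨⟨a', b'⟩, hab, e⟩
  obtain ⟨rfl, rfl⟩ := Prod.mk.inj e
  have := h _ _ hab
  simp only
  omega

lemma Touched.of_mirror {v : ℕ} (hK : Ordered n K) (hv : v ≤ n)
    (h : Touched (mirror n K) v) : Touched K (n - v) := by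
  obtain ⟨w, hw, ⟨⟨a, b⟩, hab, e⟩ | ⟨⟨a, b⟩, hab, e⟩⟩ := h
  · obtain ⟨e1, e2⟩ := Prod.mk.inj e
    have := hK _ _ hab
    simp only at e1 e2
    exact ⟨a, by omega, Or.inr ((show n - v = b by omega) ▸ hab)⟩
  · obtain ⟨e1, e2⟩ := Prod.mk.inj e
    have := hK _ _ hab
    simp only at e1 e2
    exact ⟨b, by omega, Or.inl ((show n - v = a by omega) ▸ hab)⟩

lemma touchCount_mirror_le (hK : Ordered (2 * m + 2) K) :
    touchCount (mirror (2 * m + 2) K) 1 m ≤ touchCount K (m + 2) (2 * m + 1) := by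
  classical
  refine Finset.card_le_card_of_injOn (fun v => 2 * m + 2 - v) ?_ ?_
  · intro v hv
    simp only [Finset.coe_filter, Finset.mem_Icc, Set.mem_ofPred_eq] at hv ⊢
    exact ⟨⟨by omega, by omega⟩, hv.2.of_mirror hK (by omega)⟩
  · intro v hv w hw h
    simp only [Finset.coe_filter, Finset.mem_Icc, Set.mem_ofPred_eq] at hv hw h
    omega

lemma exists_seq_of_reflTransGen {α : Type*} {r : α → α → Prop} {a b : α}
    (h : Relation.ReflTransGen r a b) :
    ∃ (f : ℕ → α) (T : ℕ), f 0 = a ∧ f T = b ∧ ∀ t < T, r (f t) (f (t + 1)) := by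
  induction h with
  | refl => exact ⟨fun _ => a, 0, rfl, rfl, by simp⟩
  | @tail b c _ h2 ih =>
    obtain ⟨f, T, h0, h1, hf⟩ := ih
    refine ⟨fun t => if t ≤ T then f t else c, T + 1, by simpa using h0, by simp, fun t ht => ?_⟩
    rcases Nat.lt_or_ge t T with h | h
    · simpa [h.le, Nat.succ_le_of_lt h] using hf t h
    · obtain rfl : t = T := by omega
      simpa [h1] using h2

lemma reflTransGen_of_seq {α : Type*} {r : α → α → Prop} (f : ℕ → α) {i j : ℕ} (hij : i ≤ j)
    (h : ∀ t, i ≤ t → t < j → r (f t) (f (t + 1))) : Relation.ReflTransGen r (f i) (f j) := by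
  induction j, hij using Nat.le_induction with
  | base => exact .refl
  | succ j hj ih => exact (ih fun t h1 h2 => h t h1 (by omega)).tail (h j hj (by omega))

lemma reflTransGen_symm {α : Type*} {r : α → α → Prop} (hr : ∀ x y, r x y → r y x) {a b : α}
    (h : Relation.ReflTransGen r a b) : Relation.ReflTransGen r b a := by
  induction h with
  | refl => exact .refl
  | tail _ h2 ih => exact ih.head (hr _ _ h2)

/-- The knowledge sets of a walk of the game cannot move from the left part `0, …, m` of the path
to a deduction of the middle vertex from outside the left part, touching less than `R` vertices of
the left part after the start. -/
lemma Requires.not_transfer (h : Requires m R) (K : ℕ → KnowledgeSet ℕ) {i j : ℕ} (hij : i < j)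
    (hK : ∀ t, i ≤ t → t ≤ j → Ordered n (K t))
    (hstep : ∀ t, i ≤ t → t < j → LineStep (K t) (K (t + 1)))
    (h0 : ∀ a b, (a, b) ∈ K i → a = b ∨ b ≤ m)
    (hsmall : ∀ t, i < t → t ≤ j → touchCount (K t) 1 m < R)
    (hT : ∀ a b, (a, b) ∈ K j → b ≤ m + 1 → a = b)
    (hgoal : HasPath (contract (fun v => min v (m + 1)) (K j)) 0 (m + 1)) : False := by
  set γ : ℕ → ℕ := fun v => min v (m + 1) with hγ
  have hγm : Monotone γ := fun a b hab => min_le_min_right _ hab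
  have hγs : ∀ i, γ (i + 1) = γ i ∨ γ (i + 1) = γ i + 1 := fun i => by simp only [hγ]; omega
  have good1 : ∀ t, i < t → t ≤ j → Ordered (m + 1) (restrict (m + 1) (K t)) ∧
      touchCount (restrict (m + 1) (K t)) 1 m < R := by
    intro t h1 h2
    refine ⟨fun a b hab => ⟨(hK t h1.le h2 a b hab.1).1, hab.2⟩, lt_of_le_of_lt ?_ (hsmall t h1 h2)⟩
    refine touchCount_le_of_imp 0 fun v _ _ => ?_
    rintro ⟨w, hw, hvw | hvw⟩
    · exact ⟨w, hw, Or.inl hvw.1⟩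
    · exact ⟨w, hw, Or.inr hvw.1⟩
  have good2 : ∀ t, i < t → t ≤ j → Ordered (m + 1) (contract γ (K t)) ∧
      touchCount (contract γ (K t)) 1 m < R := by
    intro t h1 h2
    refine ⟨(hK t h1.le h2).contract hγm (by simp [hγ]), lt_of_le_of_lt ?_ (hsmall t h1 h2)⟩
    refine touchCount_le_of_imp 0 fun v _ hv => Touched.of_contract fun a ha => ?_
    simp only [hγ] at ha
    omega
  -- The time `i` itself may touch too many vertices, so the walks start at `i + 1`. One edge `e → e
  -- + 1` can extend knowledge from the left part at most to `m + 1`, and only if `e = m`; it cannot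
  -- lead on from there, so nothing straddles the middle.
  have hmid : ∀ a b, (a, b) ∈ K (i + 1) → a = b ∨ b ≤ m + 1 ∨ m + 1 ≤ a := by
    obtain ⟨e, he, -⟩ := hstep i le_rfl hij
    have key : ∀ a b, HasPath (K i ∪ {(e, e + 1)}) a b →
        a = b ∨ b ≤ m ∨ (b = m + 1 ∧ e = m) ∨ m + 1 ≤ a := by
      intro a b hp
      induction hp with
      | refl => exact Or.inl rfl
      | @tail c d _ h2 ih =>
        rcases h2 with h2 | h2
        · rcases h0 _ _ h2 with rfl | h3
          · exact ih
          · omega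
        · have h2 : (c, d) = (e, e + 1) := h2
          obtain ⟨rfl, rfl⟩ := Prod.mk.inj h2
          omega
    intro a b hab
    have := key a b (he a b hab)
    omega
  -- Without straddling edges, contraction to the left part and restriction to it differ only by
  -- loops. They can be deduced from each other, and the edge used for the step is irrelevant.
  have hlink : SmallStep m R (restrict (m + 1) (K (i + 1))) (contract γ (K (i + 1))) := by
    refine ⟨⟨0, fun a b hab => ?_, fun a b hab => ?_⟩, good1 _ (by omega) (by omega),
      good2 _ (by omega) (by omega)⟩
    · obtain ⟨⟨a', b'⟩, hab', e⟩ := hab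
      obtain ⟨rfl, rfl⟩ := Prod.mk.inj e
      have hle := (hK (i + 1) (by omega) (by omega) _ _ hab').1
      by_cases hb : b' ≤ m + 1
      · rw [hγ]
        simp only [min_eq_left hb, min_eq_left (hle.trans hb)]
        exact .single (Or.inl ⟨hab', hb⟩)
      · have : γ a' = γ b' := by
          rcases hmid _ _ hab' with rfl | h | h
          · rfl
          · exact absurd h hb
          · simp only [hγ]; omega
        rw [this]
        exact .refl
    · have hle := (hK (i + 1) (by omega) (by omega) _ _ hab.1).1
      have hb : b ≤ m + 1 := hab.2
      have := mem_contract (γ := γ) hab.1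
      simp only [hγ, min_eq_left hb, min_eq_left (hle.trans hb)] at this
      exact .single (Or.inl this)
  -- Reversibility is decisive: run the restricted walk backwards from nothing at time `j` to time
  -- `i + 1`, change over, and run the contracted walk forwards to the goal at time `j`. The result
  -- derives `0 → m + 1` too cheaply.
  have w1 : Relation.ReflTransGen (SmallStep m R) (restrict (m + 1) (K (i + 1)))
      (restrict (m + 1) (K j)) :=
    reflTransGen_of_seq (fun t => restrict (m + 1) (K t)) hij fun t h1 h2 =>
      ⟨(hstep t (by omega) h2).restrict _ (hK _ (by omega) (by omega))
        (hK _ (by omega) (by omega)), good1 _ (by omega) (by omega), good1 _ (by omega) (by omega)⟩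
  have w2 : Relation.ReflTransGen (SmallStep m R) (contract γ (K (i + 1))) (contract γ (K j)) :=
    reflTransGen_of_seq (fun t => contract γ (K t)) hij fun t h1 h2 =>
      ⟨(hstep t (by omega) h2).contract hγs, good2 _ (by omega) (by omega),
        good2 _ (by omega) (by omega)⟩
  exact h _ _ (fun a b hab => hT a b hab.1 hab.2) hgoal
    ((reflTransGen_symm (fun _ _ => SmallStep.symm) w1).trans (w2.head hlink))

lemma touchCount_pos {lo hi v : ℕ} (hv : Touched K v) (h1 : lo ≤ v) (h2 : v ≤ hi) :
    0 < touchCount K lo hi := by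
  classical
  exact Finset.card_pos.2 ⟨v, by simp only [Finset.mem_filter, Finset.mem_Icc]; tauto⟩

/-- If no inner vertex is touched, one step can create no edge besides loops: the edge used would
have an end among `1, …, m`. -/
lemma requires_one (hm : 1 ≤ m) : Requires m 1 := by
  intro K K' h0 h1 hwalk
  have : OnlyLoops K' := by
    clear h1
    induction hwalk with
    | refl => exact h0
    | @tail b c _ h2 ih =>
      obtain ⟨⟨i, he, -⟩, -, hord, hsmall⟩ := h2
      intro x y hxy
      have key : x = y ∨ x = i ∧ y = i + 1 := by
        have hp := he x y hxy
        clear hxy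
        induction hp with
        | refl => exact Or.inl rfl
        | @tail c d _ h2 ih' =>
          rcases h2 with h2 | h2
          · rwa [← ih _ _ h2]
          · have h2 : (c, d) = (i, i + 1) := h2
            obtain ⟨rfl, rfl⟩ := Prod.mk.inj h2
            omega
      rcases key with h | ⟨rfl, rfl⟩
      · exact h
      · exfalso
        have hle := (hord _ _ hxy).2
        have hx : Touched c x := ⟨x + 1, by omega, Or.inl hxy⟩
        have hy : Touched c (x + 1) := ⟨x, by omega, Or.inr hxy⟩
        rcases Nat.eq_zero_or_pos x with h | h
        · have := touchCount_pos hy (lo := 1) (hi := m) (by omega) (by omega)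
          omega
        · have := touchCount_pos hx (lo := 1) (hi := m) (by omega) (by omega)
          omega
  have := this.eq_of_hasPath h1
  omega

/-- Contracting everything beyond `m + 1` to that vertex turns a game on the longer path into one on
the shorter path. -/
lemma Requires.mono (h : Requires m R) {m' : ℕ} (hm : m ≤ m') : Requires m' R := by
  intro K K' h0 h1 hwalk
  refine h (contract (fun v => min v (m + 1)) K) (contract (fun v => min v (m + 1)) K')
    (h0.contract _) ?_ (reflTransGen_map _ hwalk ?_)
  · have := h1.contract (fun v => min v (m + 1))
    simpa [show m ≤ m' from hm] using this
  · have good : ∀ K, Ordered (m' + 1) K ∧ touchCount K 1 m' < R →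
        Ordered (m + 1) (contract (fun v => min v (m + 1)) K) ∧
        touchCount (contract (fun v => min v (m + 1)) K) 1 m < R := by
      rintro K ⟨hK, hR⟩
      refine ⟨hK.contract (fun a b hab => min_le_min_right _ hab) (by simp), ?_⟩
      refine lt_of_le_of_lt ?_ hR
      classical
      refine Finset.card_le_card fun v hv => ?_
      simp only [Finset.mem_filter, Finset.mem_Icc] at hv ⊢
      exact ⟨⟨hv.1.1, hv.1.2.trans hm⟩, hv.2.of_contract fun a ha => by omega⟩
    rintro K K' ⟨hs, hK, hK'⟩
    exact ⟨hs.contract fun i => by omega, good _ hK, good _ hK'⟩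

/-- Doubling the length of the path increases the number of touched vertices required. -/
lemma Requires.double (h : Requires m R) (hR : 1 ≤ R) : Requires (2 * m + 1) (R + 1) := by
  intro K₀ K₁ h0 h1 hwalk
  obtain ⟨K, T, rfl, rfl, hstep⟩ := exists_seq_of_reflTransGen hwalk
  have hT0 : 0 < T := by
    rcases Nat.eq_zero_or_pos T with rfl | h
    · have := h0.eq_of_hasPath h1
      omega
    · exact h
  have hgood : ∀ t ≤ T, Ordered (2 * m + 2) (K t) ∧ touchCount (K t) 1 (2 * m + 1) < R + 1 := by
    intro t ht
    rcases Nat.lt_or_ge t T with h | h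
    · exact (hstep t h).2.1
    · have := (hstep (t - 1) (by omega)).2.2
      rwa [show t - 1 + 1 = t by omega] at this
  -- `A` and `B` say that the left or right half is saturated. The middle `m + 1` belongs to neither
  -- half. With at most `R` inner vertices touched, saturation of one half leaves nothing touched
  -- elsewhere except the ends of the whole path, so the two exclude each other.
  let A : ℕ → Prop := fun t => R ≤ touchCount (K t) 1 m
  let B : ℕ → Prop := fun t => R ≤ touchCount (K t) (m + 2) (2 * m + 1)
  have hA : ∀ t ≤ T, A t → ∀ v, Touched (K t) v → v ≤ m ∨ 2 * m + 2 ≤ v := by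
    intro t ht hAt v hv
    by_contra hcon
    have h1 := touchCount_add_one_le hv (lo := 1) (hi := m) (lo' := 1) (hi' := 2 * m + 1)
      (by omega) (by omega) le_rfl (by omega) (by omega)
    have h2 := (hgood t ht).2
    change R ≤ _ at hAt
    omega
  have hB : ∀ t ≤ T, B t → ∀ v, Touched (K t) v → v = 0 ∨ m + 2 ≤ v := by
    intro t ht hBt v hv
    by_contra hcon
    have h1 := touchCount_add_one_le hv (lo := m + 2) (hi := 2 * m + 1) (lo' := 1)
      (hi' := 2 * m + 1) (by omega) (by omega) (by omega) (by omega) (by omega)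
    have h2 := (hgood t ht).2
    change R ≤ _ at hBt
    omega
  have hAB : ∀ t ≤ T, A t → B t → False := by
    intro t ht hAt hBt
    obtain ⟨v, hv1, hv2, hv⟩ := exists_touched_of_touchCount_pos (hR.trans hBt)
    have := hA t ht hAt v hv
    omega
  let γ : ℕ → ℕ := fun v => min v (m + 1)
  let δ : ℕ → ℕ := fun v => v - (m + 1)
  have hends : ∀ t a b, (a, b) ∈ K t → a = b ∨ Touched (K t) a ∧ Touched (K t) b := by
    intro t a b hab
    by_cases h : a = b
    · exact Or.inl h
    · exact Or.inr ⟨⟨b, Ne.symm h, Or.inl hab⟩, ⟨a, h, Or.inr hab⟩⟩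
  -- a passage of the left or the right part from nothing to everything needs `R` vertices there
  have passA : ∀ i j, i ≤ j → j ≤ T → OnlyLoops (contract γ (K i)) →
      HasPath (contract γ (K j)) 0 (m + 1) → ∃ t, i ≤ t ∧ t ≤ j ∧ A t := by
    intro i j hij hj h0 h1
    by_contra hcon
    push Not at hcon
    have good : ∀ t, i ≤ t → t ≤ j → Ordered (m + 1) (contract γ (K t)) ∧
        touchCount (contract γ (K t)) 1 m < R := by
      intro t h1 h2
      refine ⟨(hgood t (h2.trans hj)).1.contract (fun a b hab => min_le_min_right _ hab)
        (by simp), lt_of_le_of_lt ?_ (not_le.1 (hcon t h1 h2))⟩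
      refine touchCount_le_of_imp 0 fun v _ hv => Touched.of_contract fun a ha => ?_
      simp only [γ] at ha
      omega
    exact h _ _ h0 h1 (reflTransGen_of_seq (fun t => contract γ (K t)) hij fun t h1 h2 =>
      ⟨(hstep t (by omega)).1.contract fun i => by simp only [γ]; omega,
        good t h1 h2.le, good (t + 1) (by omega) h2⟩)
  have passB : ∀ i j, i ≤ j → j ≤ T → OnlyLoops (contract δ (K i)) →
      HasPath (contract δ (K j)) 0 (m + 1) → ∃ t, i ≤ t ∧ t ≤ j ∧ B t := by
    intro i j hij hj h0 h1
    by_contra hcon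
    push Not at hcon
    have good : ∀ t, i ≤ t → t ≤ j → Ordered (m + 1) (contract δ (K t)) ∧
        touchCount (contract δ (K t)) 1 m < R := by
      intro t h1 h2
      refine ⟨(hgood t (h2.trans hj)).1.contract (fun a b hab => Nat.sub_le_sub_right hab _)
        (show 2 * m + 2 - (m + 1) ≤ m + 1 by omega), lt_of_le_of_lt ?_ (not_le.1 (hcon t h1 h2))⟩
      refine (touchCount_le_of_imp (m + 1) fun v hv _ => Touched.of_contract fun a ha => ?_).trans
        (le_of_eq ?_)
      · simp only [δ] at ha
        omega
      · congr 1 <;> omega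
    exact h _ _ h0 h1 (reflTransGen_of_seq (fun t => contract δ (K t)) hij fun t h1 h2 =>
      ⟨(hstep t (by omega)).1.contract fun i => by simp only [δ]; omega,
        good t h1 h2.le, good (t + 1) (by omega) h2⟩)
  -- the crossing edge known at a saturated time
  let crossA : ℕ → Prop := fun t => ∃ a, a ≤ m ∧ (a, 2 * m + 2) ∈ K t
  let crossB : ℕ → Prop := fun t => ∃ b, m + 2 ≤ b ∧ (0, b) ∈ K t
  have hcrossA : ∀ t ≤ T, A t → ¬ crossA t → ∀ a b, (a, b) ∈ K t → a = b ∨ b ≤ m := by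
    intro t ht hAt hc a b hab
    rcases hends t a b hab with h | ⟨ha, hb⟩
    · exact Or.inl h
    · have h1 := hA t ht hAt a ha
      have h2 := hA t ht hAt b hb
      have h3 := (hgood t ht).1 a b hab
      by_contra hcon
      have : b = 2 * m + 2 := by omega
      exact hc ⟨a, by omega, this ▸ hab⟩
  have hcrossB : ∀ t ≤ T, B t → ¬ crossB t → ∀ a b, (a, b) ∈ K t → a = b ∨ m + 2 ≤ a := by
    intro t ht hBt hc a b hab
    rcases hends t a b hab with h | ⟨ha, hb⟩
    · exact Or.inl h
    · have h1 := hB t ht hBt a ha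
      have h2 := hB t ht hBt b hb
      have h3 := (hgood t ht).1 a b hab
      by_contra hcon
      have : a = 0 := by omega
      subst this
      exact hc ⟨b, by omega, hab⟩
  have loopsB : ∀ t ≤ T, A t → ¬ crossA t → OnlyLoops (contract δ (K t)) := by
    rintro t ht hAt hc _ _ ⟨⟨a, b⟩, hab, e⟩
    obtain ⟨rfl, rfl⟩ := Prod.mk.inj e
    have h3 := (hgood t ht).1 a b hab
    rcases hcrossA t ht hAt hc a b hab with rfl | h
    · rfl
    · simp only [δ]; omega
  have loopsA : ∀ t ≤ T, B t → ¬ crossB t → OnlyLoops (contract γ (K t)) := by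
    rintro t ht hBt hc _ _ ⟨⟨a, b⟩, hab, e⟩
    obtain ⟨rfl, rfl⟩ := Prod.mk.inj e
    have h3 := (hgood t ht).1 a b hab
    rcases hcrossB t ht hBt hc a b hab with rfl | h
    · rfl
    · simp only [γ]; omega
  have goalB : ∀ t, crossA t → HasPath (contract δ (K t)) 0 (m + 1) := by
    rintro t ⟨a, ha, hab⟩
    have := mem_contract (γ := δ) hab
    rw [show δ a = 0 by simp only [δ]; omega, show δ (2 * m + 2) = m + 1 by simp only [δ]; omega]
      at this
    exact .single this
  have goalA : ∀ t, crossB t → HasPath (contract γ (K t)) 0 (m + 1) := by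
    rintro t ⟨b, hb, hab⟩
    have := mem_contract (γ := γ) hab
    rw [show γ 0 = 0 by simp only [γ]; omega, show γ b = m + 1 by simp only [γ]; omega]
      at this
    exact .single this
  have hTA : HasPath (contract γ (K T)) 0 (m + 1) := by
    have := h1.contract γ
    rwa [show γ 0 = 0 by simp only [γ]; omega, show γ (2 * m + 1 + 1) = m + 1 by
      simp only [γ]; omega] at this
  have hTB : HasPath (contract δ (K T)) 0 (m + 1) := by
    have := h1.contract δ
    rwa [show δ 0 = 0 by simp only [δ]; omega, show δ (2 * m + 1 + 1) = m + 1 by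
      simp only [δ]; omega] at this
  -- A saturated time is high if an edge leads from the saturated half to the far end, so that the
  -- other half counts as fully passed; otherwise nothing is known about the other half.
  let hi : ℕ → Prop := fun t => t ≤ T ∧ (A t ∧ crossA t ∨ B t ∧ crossB t)
  have exists_last : ∀ (P : ℕ → Prop) (N : ℕ), (∃ t ≤ N, P t) →
      ∃ t ≤ N, P t ∧ ∀ t', t < t' → t' ≤ N → ¬ P t' := by
    classical
    rintro P N ⟨t, ht, hPt⟩
    exact ⟨Nat.findGreatest P N, Nat.findGreatest_le N, Nat.findGreatest_spec ht hPt,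
      fun t' h1 h2 => Nat.findGreatest_is_greatest h1 h2⟩
  -- The last saturated time is high: otherwise the other half would still have to be passed before
  -- `T`, which would saturate it later.
  have hex : ∃ t, hi t := by
    obtain ⟨t, ht, hsat, hlast⟩ := exists_last (fun t => A t ∨ B t) T (by
      obtain ⟨t, -, ht, hAt⟩ := passA 0 T (Nat.zero_le _) le_rfl (h0.contract γ) hTA
      exact ⟨t, ht, Or.inl hAt⟩)
    rcases hsat with hAt | hBt
    · by_cases hc : crossA t
      · exact ⟨t, ht, Or.inl ⟨hAt, hc⟩⟩
      · obtain ⟨t', h1, h2, h3⟩ := passB t T ht le_rfl (loopsB t ht hAt hc) hTB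
        rcases h1.eq_or_lt with rfl | h1
        · exact (hAB _ ht hAt h3).elim
        · exact absurd (Or.inr h3) (hlast t' h1 h2)
    · by_cases hc : crossB t
      · exact ⟨t, ht, Or.inr ⟨hBt, hc⟩⟩
      · obtain ⟨t', h1, h2, h3⟩ := passA t T ht le_rfl (loopsA t ht hBt hc) hTA
        rcases h1.eq_or_lt with rfl | h1
        · exact (hAB _ ht h3 hBt).elim
        · exact absurd (Or.inl h3) (hlast t' h1 h2)
  classical
  -- Compare the first high time `u` with the last saturated time `v` before it. `v` exists because
  -- the crossing edge at `u` requires an earlier saturation of the other half, and `v` is not high.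
  let u := Nat.find hex
  obtain ⟨huT, hu⟩ : hi u := Nat.find_spec hex
  have hmin : ∀ t, t < u → ¬ hi t := fun t ht => Nat.find_min hex ht
  have hprev : ∃ t, t < u ∧ (A t ∨ B t) := by
    rcases hu with ⟨hAu, hc⟩ | ⟨hBu, hc⟩
    · obtain ⟨t, -, h2, h3⟩ := passB 0 u (Nat.zero_le _) huT (h0.contract δ) (goalB u hc)
      rcases h2.eq_or_lt with rfl | h2
      · exact (hAB _ huT hAu h3).elim
      · exact ⟨t, h2, Or.inr h3⟩
    · obtain ⟨t, -, h2, h3⟩ := passA 0 u (Nat.zero_le _) huT (h0.contract γ) (goalA u hc)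
      rcases h2.eq_or_lt with rfl | h2
      · exact (hAB _ huT h3 hBu).elim
      · exact ⟨t, h2, Or.inl h3⟩
  have hu0 : 0 < u := by obtain ⟨t, ht, -⟩ := hprev; omega
  obtain ⟨v, hv, hsat, hlast⟩ := exists_last (fun t => A t ∨ B t) (u - 1) (by
    obtain ⟨t, ht, h⟩ := hprev
    exact ⟨t, by omega, h⟩)
  have hvu : v < u := by omega
  have hvT : v ≤ T := by omega
  have hbetween : ∀ t, v < t → t < u → ¬ A t ∧ ¬ B t := by
    intro t h1 h2
    have := hlast t h1 (by omega)
    tauto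
  have hnot := hmin v hvu
  have hstep' : ∀ t, v ≤ t → t < u → LineStep (K t) (K (t + 1)) := fun t _ ht =>
    (hstep t (by omega)).1
  -- If the same half is saturated at `v` and `u`, the other one is passed from nothing to
  -- everything in between and must be saturated there, which is impossible. If the halves differ,
  -- all knowledge moves from the half saturated at `v` to an edge bypassing that half, contrary to
  -- `Requires.not_transfer`; a mirror image handles the right half.
  rcases hu with ⟨hAu, hc⟩ | ⟨hBu, hc⟩
  · rcases hsat with hAv | hBv
    · have hcv : ¬ crossA v := fun h => hnot ⟨hvT, Or.inl ⟨hAv, h⟩⟩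
      obtain ⟨t, h2, h3, h4⟩ := passB v u hvu.le huT (loopsB v hvT hAv hcv) (goalB u hc)
      rcases h2.eq_or_lt with rfl | h2
      · exact hAB _ hvT hAv h4
      rcases h3.eq_or_lt with rfl | h3
      · exact hAB _ huT hAu h4
      exact (hbetween t h2 h3).2 h4
    · have hcv : ¬ crossB v := fun h => hnot ⟨hvT, Or.inr ⟨hBv, h⟩⟩
      refine h.not_transfer (fun t => mirror (2 * m + 2) (K t)) hvu (n := 2 * m + 2)
        (fun t _ ht => (hgood t (by omega)).1.mirror) (fun t h1 h2 => (hstep' t h1 h2).mirror _)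
        ?_ ?_ ?_ ?_
      · rintro _ _ ⟨⟨a, b⟩, hab, e⟩
        obtain ⟨rfl, rfl⟩ := Prod.mk.inj e
        rcases hcrossB v hvT hBv hcv a b hab with rfl | h
        · exact Or.inl rfl
        · right; simp only; omega
      · intro t h1 h2
        refine lt_of_le_of_lt (touchCount_mirror_le (hgood t (by omega)).1) (not_le.1 ?_)
        rcases h2.eq_or_lt with rfl | h2
        · exact fun h => hAB _ huT hAu h
        · exact (hbetween t h1 h2).2
      · rintro _ _ ⟨⟨a, b⟩, hab, e⟩ hle
        obtain ⟨rfl, rfl⟩ := Prod.mk.inj e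
        have h3 := (hgood u huT).1 a b hab
        rcases hends u a b hab with rfl | ⟨ha, hb⟩
        · rfl
        · have h1 := hA u huT hAu a ha
          simp only at hle ⊢
          omega
      · obtain ⟨a, ha, hab⟩ := hc
        have hab' : (0, 2 * m + 2 - a) ∈ mirror (2 * m + 2) (K u) :=
          ⟨_, hab, by simp⟩
        have := mem_contract (γ := γ) hab'
        rw [show γ 0 = 0 by simp only [γ]; omega, show γ (2 * m + 2 - a) = m + 1 by
          simp only [γ]; omega] at this
        exact .single this
  · rcases hsat with hAv | hBv
    · have hcv : ¬ crossA v := fun h => hnot ⟨hvT, Or.inl ⟨hAv, h⟩⟩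
      refine h.not_transfer K hvu (n := 2 * m + 2) (fun t _ ht => (hgood t (by omega)).1) hstep'
        (hcrossA v hvT hAv hcv) ?_ ?_ (goalA u hc)
      · intro t h1 h2
        refine not_le.1 ?_
        rcases h2.eq_or_lt with rfl | h2
        · exact fun h => hAB _ huT h hBu
        · exact (hbetween t h1 h2).1
      · intro a b hab hle
        have h3 := (hgood u huT).1 a b hab
        rcases hends u a b hab with rfl | ⟨ha, hb⟩
        · rfl
        · have h1 := hB u huT hBu b hb
          omega
    · have hcv : ¬ crossB v := fun h => hnot ⟨hvT, Or.inr ⟨hBv, h⟩⟩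
      obtain ⟨t, h2, h3, h4⟩ := passA v u hvu.le huT (loopsA v hvT hBv hcv) (goalA u hc)
      rcases h2.eq_or_lt with rfl | h2
      · exact hAB _ hvT h4 hBv
      rcases h3.eq_or_lt with rfl | h3
      · exact hAB _ huT h4 hBu
      exact (hbetween t h2 h3).1 h4

/-- A path with `m ≥ 2 ^ R - 1` inner vertices requires touching `R` of them. -/
lemma requires_of_two_pow_le (R : ℕ) (hm : 2 ^ (R + 1) ≤ m + 1) : Requires m (R + 1) := by
  have : ∀ R, Requires (2 ^ (R + 1) - 1) (R + 1) := by
    intro R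
    induction R with
    | zero => exact requires_one (by norm_num)
    | succ R ih =>
      have := ih.double (by omega)
      have e : 2 * (2 ^ (R + 1) - 1) + 1 = 2 ^ (R + 1 + 1) - 1 := by
        have : 1 ≤ 2 ^ (R + 1) := Nat.one_le_two_pow
        rw [pow_succ 2 (R + 1)]
        omega
      rwa [e] at this
  exact (this R).mono (by omega)

end LineGame

end SwitchingNet

namespace SwitchingNet

open KnowledgeSet

/-! ### From accepting walks to the line game -/

section Extraction

/-- The vertices that are ends of edges of `K` other than loops. -/
def support {V : Type*} (K : KnowledgeSet V) : Set V :=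
  {v | ∃ w, w ≠ v ∧ ((v, w) ∈ K ∨ (w, v) ∈ K)}

/-- The part of a knowledge set that concerns a sequence of vertices. -/
def pullback {V : Type*} {k : ℕ} (g : Fin (k + 2) → V) (K : KnowledgeSet V) : KnowledgeSet ℕ :=
  {p | ∃ i j : Fin (k + 2), p = ((i : ℕ), (j : ℕ)) ∧ (g i, g j) ∈ K}

/-- `G` is the graph consisting of the path `g` and of edges joining the other vertices to its
ends. -/
structure IsAugmentedPath {V : Type*} {k : ℕ} (s t : V) (g : Fin (k + 2) → V) (L : Set V)
    (G : InputGraph V) : Prop where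
  injective : Function.Injective g
  map_zero : g 0 = s
  map_last : g (Fin.last (k + 1)) = t
  adj_iff : ∀ v w, G.Adj v w ↔
    (v = s ∧ w ∉ Set.range g ∧ w ∈ L) ∨ (v ∉ Set.range g ∧ v ∉ L ∧ w = t) ∨
      ∃ i j : Fin (k + 2), (i : ℕ) + 1 = j ∧ v = g i ∧ w = g j

/-- Everything in `K` is true for the paths of `G`. -/
def Truthful {V : Type*} (G : InputGraph V) (K : KnowledgeSet V) : Prop :=
  ∀ a b, (a, b) ∈ K → G.HasPath a b

variable {V : Type*} {k : ℕ} {s t : V} {g : Fin (k + 2) → V} {L : Set V} {G : InputGraph V}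
  {K K' : KnowledgeSet V}

lemma Truthful.hasPath (h : Truthful G K) {a b : V} (hp : HasPath K a b) : G.HasPath a b := by
  induction hp with
  | refl => exact .refl
  | tail _ h2 ih => exact ih.trans (h _ _ h2)

namespace IsAugmentedPath

variable (hG : IsAugmentedPath s t g L G)

include hG

/-- The side edges are dead ends: a vertex of `L` off the path has no successor, and a vertex
hanging on `t` has no predecessor and leads only to `t`, which has no successor. -/
lemma hasPath_cases {a b : V} (h : G.HasPath a b) :
    a = b ∨ (a = s ∧ b ∉ Set.range g ∧ b ∈ L) ∨ (a ∉ Set.range g ∧ a ∉ L ∧ b = t) ∨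
      ∃ i j : Fin (k + 2), i ≤ j ∧ a = g i ∧ b = g j := by
  have hs : s ∈ Set.range g := ⟨0, hG.map_zero⟩
  have ht : t ∈ Set.range g := ⟨_, hG.map_last⟩
  induction h with
  | refl => exact Or.inl rfl
  | @tail b c _ h2 ih =>
    rw [hG.adj_iff] at h2
    rcases ih with rfl | ⟨rfl, h3, h4⟩ | ⟨h3, h4, rfl⟩ | ⟨i, j, hij, rfl, rfl⟩
    · rcases h2 with h | h | ⟨i, j, hij, rfl, rfl⟩
      · exact Or.inr (Or.inl h)
      · exact Or.inr (Or.inr (Or.inl h))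
      · exact Or.inr (Or.inr (Or.inr ⟨i, j, Fin.le_def.2 (by omega), rfl, rfl⟩))
    · rcases h2 with ⟨rfl, -⟩ | ⟨-, h, -⟩ | ⟨i, j, hij, rfl, rfl⟩
      · exact absurd hs h3
      · exact absurd h4 h
      · exact absurd ⟨i, rfl⟩ h3
    · rcases h2 with ⟨h5, -⟩ | ⟨h, -, -⟩ | ⟨i, j, hij, h5, rfl⟩
      · rw [← hG.map_zero, ← hG.map_last] at h5
        have := hG.injective h5
        simp [Fin.ext_iff] at this
      · exact absurd ht h
      · rw [← hG.map_last] at h5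
        have := hG.injective h5
        rw [Fin.ext_iff, Fin.val_last] at this
        omega
    · rcases h2 with ⟨h5, h6, h7⟩ | ⟨h, -, -⟩ | ⟨i', j', hij', h5, rfl⟩
      · rw [← hG.map_zero] at h5
        have := hG.injective h5
        subst this
        have : i = 0 := by simpa using hij
        exact Or.inr (Or.inl ⟨by rw [this, hG.map_zero], h6, h7⟩)
      · exact absurd ⟨j, rfl⟩ h
      · have := hG.injective h5
        subst this
        exact Or.inr (Or.inr (Or.inr ⟨i, j', Fin.le_def.2 (by
          have := Fin.le_def.1 hij; omega), rfl, rfl⟩))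

lemma le_of_hasPath {i j : Fin (k + 2)} (h : G.HasPath (g i) (g j)) : i ≤ j := by
  rcases hG.hasPath_cases h with h | ⟨-, h, -⟩ | ⟨h, -⟩ | ⟨i', j', hij, h1, h2⟩
  · exact (hG.injective h).le
  · exact absurd ⟨j, rfl⟩ h
  · exact absurd ⟨i, rfl⟩ h
  · rwa [hG.injective h1, hG.injective h2]

lemma ordered_pullback (hK : Truthful G K) : Ordered (k + 1) (pullback g K) := by
  rintro a b ⟨i, j, h, hij⟩
  obtain ⟨rfl, rfl⟩ := Prod.mk.inj h
  exact ⟨Fin.le_def.1 (hG.le_of_hasPath (hK _ _ hij)), by omega⟩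

/-- A truthful path between two vertices of `g` cannot leave `g`, because vertices off the path
cannot be passed through. So restricting `K` to `g` loses no deduction. -/
lemma hasPath_pullback (hK : Truthful G K) {i j : Fin (k + 2)} (h : HasPath K (g i) (g j)) :
    HasPath (pullback g K) i j := by
  have key : ∀ b, HasPath K (g i) b → ∀ j, b = g j → HasPath (pullback g K) (i : ℕ) (j : Fin _) := by
    intro b hb
    induction hb with
    | refl => intro j hj; rw [hG.injective hj]; exact .refl
    | @tail c d h1 h2 ih =>
      rintro j rfl
      rcases hG.hasPath_cases (hK _ _ h2) with h | ⟨-, h, -⟩ | ⟨h3, h4, -⟩ | ⟨i', j', hij, rfl, h3⟩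
      · exact ih j h
      · exact absurd ⟨j, rfl⟩ h
      · exfalso
        rcases hG.hasPath_cases (hK.hasPath h1) with h | ⟨-, -, h⟩ | ⟨h, -⟩ | ⟨i', j', -, -, h⟩
        · exact h3 ⟨i, h⟩
        · exact h4 h
        · exact h ⟨i, rfl⟩
        · exact h3 ⟨j', h.symm⟩
      · exact (ih i' rfl).tail ⟨i', j, rfl, h2⟩
  exact key _ h j rfl

lemma exists_pullback_edge {v w : V} (hvw : G.Adj v w) :
    ∃ e, ∀ i j : Fin (k + 2), v = g i → w = g j → (i : ℕ) = e ∧ (j : ℕ) = e + 1 := by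
  by_cases h : ∃ e, v = g e
  · obtain ⟨e, rfl⟩ := h
    refine ⟨e, fun i j h1 h2 => ?_⟩
    have := hG.injective h1
    subst this
    refine ⟨rfl, ?_⟩
    rcases (hG.adj_iff _ _).1 hvw with ⟨-, h, -⟩ | ⟨h, -⟩ | ⟨i', j', hij, h3, h4⟩
    · exact absurd ⟨j, h2.symm⟩ h
    · exact absurd ⟨_, rfl⟩ h
    · rw [hG.injective h3, ← hij.symm, hG.injective (h2.symm.trans h4)]
  -- An edge starting off the path has no trace on the line, so any index will do.
  · exact ⟨0, fun i j h1 => absurd ⟨i, h1⟩ h⟩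

lemma lineStep_pullback (hK : Truthful G K) (hK' : Truthful G K') {v w : V} (hvw : G.Adj v w)
    (h1 : ∀ a b, (a, b) ∈ K' → HasPath (K ∪ {(v, w)}) a b)
    (h2 : ∀ a b, (a, b) ∈ K → HasPath (K' ∪ {(v, w)}) a b) :
    LineStep (pullback g K) (pullback g K') := by
  obtain ⟨e, he⟩ := hG.exists_pullback_edge hvw
  have key : ∀ K, Truthful G K → ∀ i j, HasPath (K ∪ {(v, w)}) (g i) (g j) →
      HasPath (pullback g K ∪ {(e, e + 1)}) i j := by
    intro K hK i j h
    refine (hG.hasPath_pullback (K := K ∪ {(v, w)}) ?_ h).mono ?_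
    · rintro a b (hab | hab)
      · exact hK a b hab
      · obtain ⟨rfl, rfl⟩ := Prod.mk.inj hab
        exact .single hvw
    · rintro _ ⟨i, j, rfl, hij | hij⟩
      · exact Or.inl ⟨i, j, rfl, hij⟩
      · obtain ⟨h1, h2⟩ := Prod.mk.inj hij
        obtain ⟨h3, h4⟩ := he i j h1.symm h2.symm
        exact Or.inr (by rw [h3, h4]; rfl)
  refine ⟨e, ?_, ?_⟩
  · rintro a b ⟨i, j, h, hij⟩
    obtain ⟨rfl, rfl⟩ := Prod.mk.inj h
    exact key K hK i j (h1 _ _ hij)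
  · rintro a b ⟨i, j, h, hij⟩
    obtain ⟨rfl, rfl⟩ := Prod.mk.inj h
    exact key K' hK' i j (h2 _ _ hij)

lemma touchCount_pullback_union_le {v w : V} (hvw : G.Adj v w) :
    touchCount (pullback g (K ∪ {(v, w)})) 1 k ≤ touchCount (pullback g K) 1 k + 2 := by
  classical
  obtain ⟨e, he⟩ := hG.exists_pullback_edge hvw
  unfold touchCount
  refine le_trans (Finset.card_le_card (t := (Finset.Icc 1 k).filter (Touched (pullback g K)) ∪
    {e, e + 1}) ?_) ((Finset.card_union_le _ _).trans (by gcongr; exact Finset.card_le_two))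
  intro x hx
  simp only [Finset.mem_union, Finset.mem_filter, Finset.mem_insert, Finset.mem_singleton] at hx ⊢
  obtain ⟨hx, y, hy, ⟨i, j, h, hij⟩ | ⟨i, j, h, hij⟩⟩ := hx
  · obtain ⟨rfl, rfl⟩ := Prod.mk.inj h
    rcases hij with hij | hij
    · exact Or.inl ⟨hx, j, hy, Or.inl ⟨i, j, rfl, hij⟩⟩
    · obtain ⟨h1, h2⟩ := Prod.mk.inj hij
      exact Or.inr (Or.inl (he i j h1.symm h2.symm).1)
  · obtain ⟨rfl, rfl⟩ := Prod.mk.inj h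
    rcases hij with hij | hij
    · exact Or.inl ⟨hx, i, hy, Or.inr ⟨i, j, rfl, hij⟩⟩
    · obtain ⟨h1, h2⟩ := Prod.mk.inj hij
      exact Or.inr (Or.inr (he i j h1.symm h2.symm).2)

/-- Truthful knowledge reveals the side of each vertex off the path that it mentions: edges can only
enter vertices attached to `s` and only leave vertices attached to `t`. This yields the predictions
for the count. -/
lemma mem_iff_of_truthful (hK : Truthful G K) {v : V} (hv : v ∈ support K)
    (hvg : v ∉ Set.range g) : v ∈ L ↔ ∃ a, a ≠ v ∧ (a, v) ∈ K := by
  have ht : t ∈ Set.range g := ⟨_, hG.map_last⟩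
  have hs : s ∈ Set.range g := ⟨_, hG.map_zero⟩
  constructor
  · intro hL
    obtain ⟨w, hw, h | h⟩ := hv
    · exfalso
      rcases hG.hasPath_cases (hK _ _ h) with h | ⟨rfl, -⟩ | ⟨-, h, -⟩ | ⟨i, -, -, h, -⟩
      · exact hw h.symm
      · exact hvg hs
      · exact h hL
      · exact hvg ⟨i, h.symm⟩
    · exact ⟨w, hw, h⟩
  · rintro ⟨a, ha, h⟩
    rcases hG.hasPath_cases (hK _ _ h) with h | ⟨-, -, h⟩ | ⟨-, -, rfl⟩ | ⟨-, j, -, -, h⟩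
    · exact absurd h ha
    · exact h
    · exact absurd ht hvg
    · exact absurd ⟨j, h.symm⟩ hvg

/-- A certain-knowledge network accepting a long augmented path has a node whose knowledge set is
truthful and touches many vertices of the path. -/
lemma exists_node {W : Network V} {K : W.Node → KnowledgeSet V} {r : ℕ} (hst : s ≠ t)
    (hmono : W.IsMonotone) (hK : W.IsValidDescription s t K) (hacc : W.Accepts G)
    (hreq : Requires k (r + 2)) :
    ∃ y ∈ W.graph.vertexSet, Truthful G (K y) ∧ r ≤ touchCount (pullback g (K y)) 1 k := by
  by_contra hcon
  push Not at hcon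
  obtain ⟨h0, h1, hstep⟩ := hK
  have hloops : ∀ a b, (a, b) ∈ K W.src → a = b := by
    intro a b hab
    by_contra hne
    have : (a, b) ∈ closure s t (K W.src) := ⟨hne, Or.inr (.single hab)⟩
    rw [h0] at this
    exact this.2.elim (not_hasPath_empty hst) (not_hasPath_empty hne)
  have hstart : OnlyLoops (pullback g (K W.src)) := by
    rintro a b ⟨i, j, h, hij⟩
    obtain ⟨rfl, rfl⟩ := Prod.mk.inj h
    exact congrArg _ (hG.injective (hloops _ _ hij))
  have hgoal : ∀ K, Truthful G K → HasPath K s t → HasPath (pullback g K) 0 (k + 1) := by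
    intro K hK h
    rw [← hG.map_zero, ← hG.map_last] at h
    exact hG.hasPath_pullback hK h
  have key : ∀ y, Relation.ReflTransGen
      (fun x y => ∃ e, W.graph.IsLink e x y ∧ (W.label e).Consistent G) W.src y →
      y ∈ W.graph.vertexSet ∧ Truthful G (K y) ∧ Relation.ReflTransGen (SmallStep k (r + 2))
        (pullback g (K W.src)) (pullback g (K y)) := by
    intro y hy
    induction hy with
    | refl => exact ⟨W.src_mem, fun a b hab => hloops a b hab ▸ .refl, .refl⟩
    | @tail b c _ h2 ih =>
      obtain ⟨hb, htrue, hwalk⟩ := ih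
      obtain ⟨e, he, hcons⟩ := h2
      obtain ⟨v, w, hvw⟩ := hmono e he.edge_mem
      rw [hvw] at hcons
      have hadj : G.Adj v w := hcons
      obtain ⟨le1, le2⟩ := hstep e b c v w he hvw
      have hsmall := hcon b hb htrue
      have gb : Ordered (k + 1) (pullback g (K b)) ∧ touchCount (pullback g (K b)) 1 k < r + 2 :=
        ⟨hG.ordered_pullback htrue, by omega⟩
      have htrue' : Truthful G (K b ∪ {(v, w)}) := by
        rintro x y (hxy | hxy)
        · exact htrue x y hxy
        · obtain ⟨rfl, rfl⟩ := Prod.mk.inj hxy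
          exact .single hadj
      -- Knowledge with a path from `s` to `t` would allow arbitrary, even false, deductions. The
      -- first occurrence of such knowledge, before any closure, would already win the line game;
      -- adding the label touches at most two more vertices, which explains `r + 2`.
      have hno : ¬ HasPath (K b ∪ {(v, w)}) s t := by
        intro h
        refine hreq _ _ hstart (hgoal _ htrue' h) (hwalk.tail ⟨hG.lineStep_pullback htrue htrue' hadj
          ?_ ?_, gb, hG.ordered_pullback htrue', ?_⟩)
        · exact fun x y hxy => .single hxy
        · exact fun x y hxy => .single (Or.inl (Or.inl hxy))
        · have := hG.touchCount_pullback_union_le (K := K b) hadj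
          omega
      have d1 : ∀ x y, (x, y) ∈ K c → HasPath (K b ∪ {(v, w)}) x y := fun x y hxy =>
        (le_iff.1 le1 x y hxy).resolve_left hno
      have hno' : ¬ HasPath (K c ∪ {(v, w)}) s t := by
        intro h
        refine hno (h.of_forall ?_)
        rintro x y (hxy | hxy)
        · exact d1 x y hxy
        · exact .single (Or.inr hxy)
      have d2 : ∀ x y, (x, y) ∈ K b → HasPath (K c ∪ {(v, w)}) x y := fun x y hxy =>
        (le_iff.1 le2 x y hxy).resolve_left hno'
      have hc := he.right_mem
      have htruec : Truthful G (K c) := fun x y hxy => htrue'.hasPath (d1 x y hxy)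
      have := hcon c hc htruec
      exact ⟨hc, htruec, hwalk.tail ⟨hG.lineStep_pullback htrue htruec hadj d1 d2, gb,
        hG.ordered_pullback htruec, by omega⟩⟩
  obtain ⟨-, htrue, hwalk⟩ := key _ hacc
  have hst' : HasPath (K W.snk) s t := by
    have : (s, t) ∈ closure s t (K W.snk) := by
      rw [h1]
      exact ⟨hst, Or.inr (.single rfl)⟩
    exact this.2.elim id id
  exact hreq _ _ hstart (hgoal _ htrue hst') hwalk

end IsAugmentedPath

end Extraction

/-! ### Counting paths and sides matched by a pattern -/

section Counting

variable {V : Type*} [Fintype V] [DecidableEq V]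

lemma card_agree_mul_le (S : Finset V) (τ : V → Bool) {q : ℕ} (hq : q ≤ S.card) :
    ((Finset.univ : Finset (V → Bool)).filter fun c => ∀ v ∈ S, c v = τ v).card * 2 ^ q ≤
      2 ^ Fintype.card V := by
  have : ((Finset.univ : Finset (V → Bool)).filter fun c => ∀ v ∈ S, c v = τ v) ⊆
      Fintype.piFinset fun v => if v ∈ S then {τ v} else Finset.univ := by
    intro c hc
    rw [Fintype.mem_piFinset]
    intro v
    split_ifs with h
    · simpa using (Finset.mem_filter.1 hc).2 v h
    · simp
  have h2 := Finset.card_le_card this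
  rw [Fintype.card_piFinset] at h2
  have h3 : ∏ v : V, (if v ∈ S then ({τ v} : Finset Bool) else Finset.univ).card =
      2 ^ (Fintype.card V - S.card) := by
    have : ∀ v, (if v ∈ S then ({τ v} : Finset Bool) else Finset.univ).card =
        if v ∈ S then 1 else 2 := fun v => by split_ifs <;> simp
    simp only [this]
    rw [Finset.prod_ite, Finset.prod_const_one, one_mul, Finset.prod_const, ← Finset.card_compl]
    congr 2
    ext v
    simp
  rw [h3] at h2
  have hS := Finset.card_le_univ S
  calc _ ≤ 2 ^ (Fintype.card V - S.card) * 2 ^ S.card :=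
        Nat.mul_le_mul h2 (Nat.pow_le_pow_right (by norm_num) hq)
    _ = 2 ^ Fintype.card V := by rw [← pow_add]; congr 1; omega

omit [Fintype V] in
-- Union bound over the sets `J` of `r` blocks that are hit: at most `k ^ r` sets, each with at most
-- `T.card` choices in every block of `J`.
lemma card_many_hits_le {k M r : ℕ} (e : Fin k → Fin M → V)
    (he : ∀ j, Function.Injective (e j)) (T : Finset V) :
    ((Finset.univ : Finset (Fin k → Fin M)).filter fun f =>
      r ≤ (Finset.univ.filter fun j => e j (f j) ∈ T).card).card * M ^ r ≤
      (k * T.card) ^ r * M ^ k := by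
  have hsub : ((Finset.univ : Finset (Fin k → Fin M)).filter fun f =>
      r ≤ (Finset.univ.filter fun j => e j (f j) ∈ T).card) ⊆
      ((Finset.univ : Finset (Fin k)).powersetCard r).biUnion fun J =>
        Fintype.piFinset fun j => if j ∈ J then Finset.univ.filter fun a => e j a ∈ T
          else Finset.univ := by
    intro f hf
    obtain ⟨J, hJ, hJr⟩ := Finset.exists_subset_card_eq (Finset.mem_filter.1 hf).2
    refine Finset.mem_biUnion.2 ⟨J, Finset.mem_powersetCard.2 ⟨Finset.subset_univ _, hJr⟩, ?_⟩
    rw [Fintype.mem_piFinset]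
    intro j
    split_ifs with h
    · simpa using (Finset.mem_filter.1 (hJ h)).2
    · simp
  have hcard : ∀ J ∈ (Finset.univ : Finset (Fin k)).powersetCard r,
      (Fintype.piFinset fun j => if j ∈ J then Finset.univ.filter fun a => e j a ∈ T
          else Finset.univ).card ≤ T.card ^ r * M ^ (k - r) := by
    intro J hJ
    have hJr := (Finset.mem_powersetCard.1 hJ).2
    rw [Fintype.card_piFinset]
    calc _ ≤ ∏ j : Fin k, if j ∈ J then T.card else M := by
          refine Finset.prod_le_prod' fun j _ => ?_
          split_ifs
          · exact Finset.card_le_card_of_injOn (e j) (fun a ha => by simpa using ha)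
              (he j).injOn
          · simp
      _ = T.card ^ r * M ^ (k - r) := by
          rw [Finset.prod_ite, Finset.prod_const, Finset.prod_const]
          congr 2
          · rw [← hJr]; congr 1; ext; simp
          · have := Finset.card_compl J
            rw [Fintype.card_fin, hJr] at this
            rw [← this]; congr 1; ext; simp
  have h1 := (Finset.card_le_card hsub).trans (Finset.card_biUnion_le_card_mul _ _ _ hcard)
  rw [Finset.card_powersetCard, Finset.card_univ, Fintype.card_fin] at h1
  rcases Nat.lt_or_ge k r with hkr | hkr
  · rw [Nat.choose_eq_zero_of_lt hkr, zero_mul] at h1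
    rw [Nat.le_zero.1 h1, zero_mul]
    exact Nat.zero_le _
  · calc _ ≤ k ^ r * (T.card ^ r * M ^ (k - r)) * M ^ r := by
          gcongr
          exact h1.trans (Nat.mul_le_mul_right _ (Nat.choose_le_pow k r))
      _ = (k * T.card) ^ r * (M ^ (k - r) * M ^ r) := by rw [mul_pow]; ring
      _ = (k * T.card) ^ r * M ^ k := by rw [← pow_add]; congr 2; omega

/-- If for every choice of one vertex from each of `k` disjoint blocks of size `M` and of a
two-colouring of the vertices one of the patterns `(T y, τ y)` matches, in that it meets at least
`r` of the chosen vertices and predicts the colours of its other vertices, then there are many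
patterns. -/
lemma le_card_of_cover {Y : Type*} {k M r q Z : ℕ} (ys : Finset Y) (T : Y → Finset V)
    (τ : Y → V → Bool) (e : Fin k → Fin M → V) (he : ∀ j, Function.Injective (e j)) (hM : 0 < M)
    (hcover : ∀ (f : Fin k → Fin M) (c : V → Bool), ∃ y ∈ ys,
      r ≤ (Finset.univ.filter fun j => e j (f j) ∈ T y).card ∧
      ∀ v ∈ T y, v ∉ Set.range (fun j => e j (f j)) → c v = τ y v)
    (hZq : Z ≤ 2 ^ q) (hZM : Z * (k * (k + q)) ^ r ≤ M ^ r) : Z ≤ ys.card := by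
  classical
  let bad : Y → Finset ((Fin k → Fin M) × (V → Bool)) := fun y => Finset.univ.filter fun p =>
    r ≤ (Finset.univ.filter fun j => e j (p.1 j) ∈ T y).card ∧
      ∀ v ∈ T y, v ∉ Set.range (fun j => e j (p.1 j)) → p.2 v = τ y v
  have hsub : (Finset.univ : Finset ((Fin k → Fin M) × (V → Bool))) ⊆ ys.biUnion bad := by
    rintro ⟨f, c⟩ _
    obtain ⟨y, hy, h⟩ := hcover f c
    exact Finset.mem_biUnion.2 ⟨y, hy, Finset.mem_filter.2 ⟨Finset.mem_univ _, h⟩⟩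
  have hbad : ∀ y, (bad y).card * Z ≤ M ^ k * 2 ^ Fintype.card V := by
    intro y
    -- A small pattern rarely hits `r` path vertices. A pattern of size at least `k + q` has `q`
    -- vertices off the path, and predicting their colours succeeds with probability at most `2 ^
    -- (-q)`.
    rcases Nat.lt_or_ge (T y).card (k + q) with hT | hT
    · have h1 : (bad y).card ≤ ((Finset.univ : Finset (Fin k → Fin M)).filter fun f =>
          r ≤ (Finset.univ.filter fun j => e j (f j) ∈ T y).card).card * 2 ^ Fintype.card V := by
        have : bad y ⊆ ((Finset.univ : Finset (Fin k → Fin M)).filter fun f =>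
            r ≤ (Finset.univ.filter fun j => e j (f j) ∈ T y).card) ×ˢ Finset.univ := by
          intro p hp
          simp only [bad, Finset.mem_filter, Finset.mem_product, Finset.mem_univ, true_and,
            and_true] at hp ⊢
          exact hp.1
        refine (Finset.card_le_card this).trans ?_
        rw [Finset.card_product, Finset.card_univ, Fintype.card_fun, Fintype.card_bool]
      have h2 := card_many_hits_le (r := r) e he (T y)
      refine Nat.le_of_mul_le_mul_right ?_ (pow_pos hM r)
      calc (bad y).card * Z * M ^ r ≤ (_ * 2 ^ Fintype.card V) * Z * M ^ r := by gcongr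
        _ = (_ * M ^ r) * 2 ^ Fintype.card V * Z := by ring
        _ ≤ ((k * (T y).card) ^ r * M ^ k) * 2 ^ Fintype.card V * Z := by gcongr
        _ ≤ ((k * (k + q)) ^ r * M ^ k) * 2 ^ Fintype.card V * Z := by gcongr
        _ = M ^ k * 2 ^ Fintype.card V * (Z * (k * (k + q)) ^ r) := by ring
        _ ≤ M ^ k * 2 ^ Fintype.card V * M ^ r := by gcongr
    · have h1 : (bad y).card * 2 ^ q ≤ M ^ k * 2 ^ Fintype.card V := by
        have : bad y ⊆ (Finset.univ : Finset (Fin k → Fin M)).biUnion fun f => {f} ×ˢ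
            ((Finset.univ : Finset (V → Bool)).filter fun c =>
              ∀ v ∈ T y \ Finset.univ.image (fun j => e j (f j)), c v = τ y v) := by
          rintro ⟨f, c⟩ hp
          refine Finset.mem_biUnion.2 ⟨f, Finset.mem_univ _, Finset.mem_product.2
            ⟨Finset.mem_singleton_self _, Finset.mem_filter.2 ⟨Finset.mem_univ _, ?_⟩⟩⟩
          intro v hv
          rw [Finset.mem_sdiff, Finset.mem_image] at hv
          refine (Finset.mem_filter.1 hp).2.2 v hv.1 ?_
          rintro ⟨j, hj⟩
          exact hv.2 ⟨j, Finset.mem_univ _, hj⟩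
        calc (bad y).card * 2 ^ q ≤ (∑ f : Fin k → Fin M, _) * 2 ^ q :=
              Nat.mul_le_mul_right _ ((Finset.card_le_card this).trans Finset.card_biUnion_le)
          _ ≤ ∑ _f : Fin k → Fin M, 2 ^ Fintype.card V := by
              rw [Finset.sum_mul]
              refine Finset.sum_le_sum fun f _ => ?_
              rw [Finset.card_product, Finset.card_singleton, one_mul]
              refine card_agree_mul_le _ _ ?_
              have h3 := Finset.le_card_sdiff (Finset.univ.image fun j => e j (f j)) (T y)
              have h4 : (Finset.univ.image fun j => e j (f j)).card ≤ k :=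
                Finset.card_image_le.trans (by simp)
              omega
          _ = M ^ k * 2 ^ Fintype.card V := by simp
      exact (Nat.mul_le_mul_left _ hZq).trans h1
  have htotal : M ^ k * 2 ^ Fintype.card V ≤ ∑ y ∈ ys, (bad y).card := by
    have := (Finset.card_le_card hsub).trans Finset.card_biUnion_le
    simpa using this
  refine Nat.le_of_mul_le_mul_right (c := M ^ k * 2 ^ Fintype.card V) ?_ (by positivity)
  calc Z * (M ^ k * 2 ^ Fintype.card V) ≤ Z * ∑ y ∈ ys, (bad y).card := by gcongr
    _ = ∑ y ∈ ys, (bad y).card * Z := by rw [Finset.mul_sum]; simp only [mul_comm]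
    _ ≤ ∑ _y ∈ ys, M ^ k * 2 ^ Fintype.card V := Finset.sum_le_sum fun y _ => hbad y
    _ = ys.card * (M ^ k * 2 ^ Fintype.card V) := by rw [Finset.sum_const, smul_eq_mul]

end Counting

end SwitchingNet

namespace SwitchingNet

open KnowledgeSet

/-! ### The lower bound for certain-knowledge networks -/

section LowerBound

/-- Lower bound for the certain-knowledge complexity of the augmented paths. -/
lemma le_certainKnowledgeComplexity {n k M r q Z : ℕ} (hkM : k * M ≤ n) (hM : 0 < M)
    (hreq : Requires k (r + 2)) (hZq : Z ≤ 2 ^ q) (hZM : Z * (k * (k + q)) ^ r ≤ M ^ r) :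
    (Z : ℕ∞) ≤ certainKnowledgeComplexity 0 (Fin.last (n + 1))
      (augmentedPaths (0 : Fin (n + 2)) (Fin.last (n + 1)) k) := by
  classical
  have hst : (0 : Fin (n + 2)) ≠ Fin.last (n + 1) := by simp [Fin.ext_iff]
  refine le_iInf₂ fun W ⟨⟨hmono, K, hK⟩, hsolve⟩ => ?_
  have hlt : ∀ (j : Fin k) (a : Fin M), (j : ℕ) * M + a < k * M := fun j a =>
    calc (j : ℕ) * M + a < j * M + M := by have := a.2; omega
      _ = (j + 1) * M := by ring
      _ ≤ k * M := Nat.mul_le_mul_right _ j.2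
  -- The blocks are consecutive intervals; the shift by one avoids `s = 0`, and `k * M ≤ n` avoids
  -- `t`.
  let e : Fin k → Fin M → Fin (n + 2) := fun j a => ⟨j * M + a + 1, by have := hlt j a; omega⟩
  have he : ∀ j j' a a', e j a = e j' a' → j = j' ∧ a = a' := by
    intro j j' a a' h
    have h : (j : ℕ) * M + a = j' * M + a' := by simpa [e, Fin.ext_iff] using h
    have h1 : (j : ℕ) = j' := by
      have := congrArg (fun x => x / M) h
      simpa [mul_comm _ M, Nat.mul_add_div hM, Nat.div_eq_of_lt a.2, Nat.div_eq_of_lt a'.2]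
        using this
    rw [h1] at h
    exact ⟨Fin.ext h1, Fin.ext (by omega)⟩
  let T : W.Node → Finset (Fin (n + 2)) := fun y => Finset.univ.filter fun v => v ∈ support (K y)
  let τ : W.Node → Fin (n + 2) → Bool := fun y v => decide (∃ a, a ≠ v ∧ (a, v) ∈ K y)
  -- The ends `s` and `t` are removed from the patterns: they lie on the path but are not chosen
  -- from a block, and have no side to predict.
  have hmain := le_card_of_cover (Z := Z) (q := q) (r := r) W.finite_vertexSet.toFinset
    (fun y => (T y).filter fun v => v ≠ 0 ∧ v ≠ Fin.last (n + 1)) τ e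
    (fun j a a' h => (he j j a a' h).2) hM ?_ hZq hZM
  · rw [← Set.ncard_eq_toFinset_card _ W.finite_vertexSet] at hmain
    exact_mod_cast hmain
  intro f c
  let u : Fin k → Fin (n + 2) := fun j => e j (f j)
  have hu0 : ∀ j, u j ≠ 0 := fun j => by simp [u, e, Fin.ext_iff]
  have hu1 : ∀ j, u j ≠ Fin.last (n + 1) := fun j => by
    have := hlt j (f j)
    simp [u, e, Fin.ext_iff]
    omega
  have hinj := pathThrough_injective u (fun j j' h => (he _ _ _ _ h).1) hu0 hu1
  obtain ⟨G, hG, hadj⟩ := exists_mem_augmentedPaths (pathThrough u) hinj (pathThrough_zero u)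
    (pathThrough_last u) {v | c v = true}
  have hG' : IsAugmentedPath 0 (Fin.last (n + 1)) (pathThrough u) {v | c v = true} G :=
    ⟨hinj, pathThrough_zero u, pathThrough_last u, hadj⟩
  have hacc := hsolve.1 G hG (hasPath_of_mem_augmentedPaths hG)
  obtain ⟨y, hy, htrue, hr⟩ := hG'.exists_node hst hmono hK hacc hreq
  refine ⟨y, W.finite_vertexSet.mem_toFinset.2 hy, ?_, ?_⟩
  · have hsub : (Finset.Icc 1 k).filter (Touched (pullback (pathThrough u) (K y))) ⊆
        (Finset.univ.filter fun j : Fin k => e j (f j) ∈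
          (T y).filter fun v => v ≠ 0 ∧ v ≠ Fin.last (n + 1)).image fun j : Fin k => (j : ℕ) + 1 := by
      intro x hx
      simp only [Finset.mem_filter, Finset.mem_Icc] at hx
      obtain ⟨⟨hx1, hx2⟩, w, hw, hxw⟩ := hx
      refine Finset.mem_image.2 ⟨⟨x - 1, by omega⟩, ?_, by simp only; omega⟩
      have hidx : ∀ i : Fin (k + 2), x = i →
          pathThrough u i = u ⟨x - 1, by omega⟩ := by
        rintro i rfl
        refine (congrArg _ (Fin.ext ?_)).trans (pathThrough_inner u _)
        simp only [Fin.val_succ, Fin.val_castSucc]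
        omega
      have hsupp : u ⟨x - 1, by omega⟩ ∈ support (K y) := by
        rcases hxw with ⟨i, j, h, hij⟩ | ⟨i, j, h, hij⟩
        · obtain ⟨h1, h2⟩ := Prod.mk.inj h
          rw [← hidx i h1]
          exact ⟨_, fun h => hw (by rw [h1, h2, hinj h]), Or.inl hij⟩
        · obtain ⟨h1, h2⟩ := Prod.mk.inj h
          rw [← hidx j h2]
          exact ⟨_, fun h => hw (by rw [h1, h2, hinj h]), Or.inr hij⟩
      exact Finset.mem_filter.2 ⟨Finset.mem_univ _, Finset.mem_filter.2
        ⟨Finset.mem_filter.2 ⟨Finset.mem_univ _, hsupp⟩, hu0 _, hu1 _⟩⟩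
    refine hr.trans (le_trans (le_of_eq ?_) ((Finset.card_le_card hsub).trans Finset.card_image_le))
    unfold touchCount
    congr
  · intro v hv hvr
    simp only [T, Finset.mem_filter, Finset.mem_univ, true_and] at hv
    have hvg : v ∉ Set.range (pathThrough u) := by
      rintro ⟨i, rfl⟩
      induction i using Fin.cases with
      | zero => exact hv.2.1 rfl
      | succ i =>
        induction i using Fin.lastCases with
        | last => exact hv.2.2 (pathThrough_last u)
        | cast j => exact hvr ⟨j, (pathThrough_inner u j).symm⟩
    have := hG'.mem_iff_of_truthful htrue hv.1 hvg
    rw [Bool.eq_iff_iff]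
    simpa [τ] using this

end LowerBound

/-! ### Superpolynomial growth -/

section LowerAsymptotics

lemma IsAdmissible.tendsto {k : ℕ → ℕ} (hk : IsAdmissible k) : Tendsto k atTop atTop := by
  refine tendsto_atTop.2 fun b => ?_
  obtain ⟨c, hc0, hc⟩ := hk.isTheta.2.exists_pos
  have hlim : Tendsto (fun N : ℕ => √(Real.logb 2 N)) atTop atTop :=
    Real.tendsto_sqrt_atTop.comp ((Real.tendsto_logb_atTop (by norm_num)).comp
      tendsto_natCast_atTop_atTop)
  filter_upwards [hc.bound, hlim.eventually_gt_atTop (c * Real.logb 2 (b + 1))] with N h1 h2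
  by_contra hcon
  push Not at hcon
  rw [Real.norm_of_nonneg (Real.sqrt_nonneg _)] at h1
  have h3 : ‖Real.logb 2 (k N)‖ ≤ Real.logb 2 (b + 1) := by
    have h0 : 0 ≤ Real.logb 2 (k N) := div_nonneg (Real.log_natCast_nonneg _) (by positivity)
    rw [Real.norm_of_nonneg h0]
    rcases Nat.eq_zero_or_pos (k N) with h | h
    · rw [h]
      have := div_nonneg (Real.log_natCast_nonneg (b + 1)) (Real.log_nonneg one_le_two)
      simpa [Real.logb] using this
    · refine Real.logb_le_logb_of_le (by norm_num) (by exact_mod_cast h) ?_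
      exact_mod_cast (by omega : k N ≤ b + 1)
  have : c * ‖Real.logb 2 (k N)‖ ≤ c * Real.logb 2 (b + 1) := by gcongr
  linarith

/-- Admissible `k` and the logarithm are bounded by arbitrarily small powers. -/
lemma IsAdmissible.exists_pow_le {k : ℕ → ℕ} (hk : IsAdmissible k) (E : ℕ) :
    ∀ᶠ N : ℕ in atTop, ∃ B, k N + 2 ≤ B ∧ Nat.clog 2 N ≤ B ∧ B ^ E ≤ N := by
  obtain ⟨C, hC⟩ := hk.exists_exponent
  filter_upwards [hC, eventually_gt_atTop (2 ^ ((E + 1) ^ 2 * C))] with N ⟨m, h1, h2, h3, h4⟩ hN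
  refine ⟨2 ^ m, h2, h3, ?_⟩
  set l := Nat.clog 2 N
  have hN2 : 2 ≤ N := by
    have : 1 ≤ 2 ^ ((E + 1) ^ 2 * C) := Nat.one_le_two_pow
    omega
  have hl : (E + 1) ^ 2 * C < l := by
    refine (Nat.pow_lt_pow_iff_right one_lt_two).1 (hN.trans_le (Nat.le_pow_clog one_lt_two N))
  have hlN : 2 ^ (l - 1) < N := Nat.pow_pred_clog_lt_self one_lt_two (by omega)
  rw [← pow_mul]
  refine (Nat.pow_le_pow_right (by norm_num) ?_).trans hlN.le
  by_contra hcon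
  -- If `m * E ≥ l`, then `l ^ 2 ≤ (E + 1) ^ 2 * m ^ 2 ≤ (E + 1) ^ 2 * C * l`, contrary to `l > (E +
  -- 1) ^ 2 * C`.
  have h5 : l ≤ (E + 1) * m := by nlinarith [show l ≤ m * E by omega]
  have h6 : l ^ 2 ≤ (E + 1) ^ 2 * C * l := by
    calc l ^ 2 ≤ ((E + 1) * m) ^ 2 := Nat.pow_le_pow_left h5 2
      _ = (E + 1) ^ 2 * m ^ 2 := by ring
      _ ≤ (E + 1) ^ 2 * (C * l) := by gcongr
      _ = (E + 1) ^ 2 * C * l := by ring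
  nlinarith

lemma eval_lt_pow (p : ℕ[X]) : ∃ D, ∀ᶠ x : ℕ in atTop, p.eval x < x ^ D := by
  refine ⟨p.natDegree + 1, ?_⟩
  filter_upwards [eventually_gt_atTop (∑ i ∈ Finset.range (p.natDegree + 1), p.coeff i),
    eventually_ge_atTop 1] with x hx hx1
  rw [Polynomial.eval_eq_sum_range]
  calc ∑ i ∈ Finset.range (p.natDegree + 1), p.coeff i * x ^ i
      ≤ ∑ i ∈ Finset.range (p.natDegree + 1), p.coeff i * x ^ p.natDegree := by
        refine Finset.sum_le_sum fun i hi => ?_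
        have : i ≤ p.natDegree := by simpa [Nat.lt_succ_iff] using hi
        gcongr
    _ = (∑ i ∈ Finset.range (p.natDegree + 1), p.coeff i) * x ^ p.natDegree := by
        rw [Finset.sum_mul]
    _ < x * x ^ p.natDegree := by gcongr
    _ = x ^ (p.natDegree + 1) := by ring

/-- To beat `N ^ D`, take `r = 2 * D` hits and `q = D * lg N` predicted colours. Blocks of size
about `N / k` exceed `√N` by a margin, since `k` and `lg N` are smaller than any power of `N`. -/
lemma augmentedPathFamily_certainKnowledge_gt {k : ℕ → ℕ} (hk : IsAdmissible k) (p : ℕ[X]) :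
    ∀ᶠ n in atTop,
      ((p.eval (n + 2) : ℕ) : ℕ∞) < (augmentedPathFamily k).certainKnowledge n := by
  obtain ⟨D, hD⟩ := eval_lt_pow p
  have hev : ∀ᶠ N : ℕ in atTop, p.eval N < N ^ D ∧ 2 ^ (2 * D + 2) ≤ k N ∧ D ≤ k N ∧
      ∃ B, k N + 2 ≤ B ∧ Nat.clog 2 N ≤ B ∧ B ^ 12 ≤ N := by
    filter_upwards [hD, hk.tendsto.eventually_ge_atTop (2 ^ (2 * D + 2)),
      hk.tendsto.eventually_ge_atTop D, hk.exists_pow_le 12] with N h1 h2 h3 h4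
    exact ⟨h1, h2, h3, h4⟩
  filter_upwards [(tendsto_add_atTop_nat 2).eventually hev] with n ⟨h1, h2, h3, B, h4, h5, h6⟩
  refine (show ((p.eval (n + 2) : ℕ) : ℕ∞) < (((n + 2) ^ D : ℕ) : ℕ∞) by exact_mod_cast h1).trans_le
    ?_
  set κ := k (n + 2)
  set N := n + 2
  have hκ : 1 ≤ κ := Nat.one_le_two_pow.trans h2
  have hB2 : 2 ≤ B := by omega
  have hBN : 2 * B ≤ N := by
    refine le_trans ?_ h6
    calc 2 * B ≤ B * B := by gcongr
      _ = B ^ 2 := by ring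
      _ ≤ B ^ 12 := Nat.pow_le_pow_right (by omega) (by norm_num)
  let M := n / κ
  have hκM : κ * M ≤ n := Nat.mul_div_le n κ
  have hMB : N ≤ 2 * (M * B) := by
    have h7 : n < κ * M + κ := Nat.lt_mul_div_succ n hκ
    have h8 : κ * M ≤ B * M := by gcongr; omega
    have : N = n + 2 := rfl
    nlinarith
  -- The exponent `12` comes from here: `M ≥ N / (2 * B)` loses `4 * B ^ 2 ≤ B ^ 4` on squaring, and
  -- `(B ^ 4) ^ 2` is to be covered as well.
  have hM2 : N * (B ^ 4) ^ 2 ≤ M ^ 2 := by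
    refine Nat.le_of_mul_le_mul_right (c := 4 * B ^ 2) ?_ (by positivity)
    calc N * (B ^ 4) ^ 2 * (4 * B ^ 2) ≤ N * (B ^ 4) ^ 2 * (B ^ 2 * B ^ 2) := by
          gcongr
          nlinarith
      _ = N * B ^ 12 := by ring
      _ ≤ N * N := by gcongr
      _ ≤ (2 * (M * B)) * (2 * (M * B)) := by gcongr
      _ = M ^ 2 * (4 * B ^ 2) := by ring
  have hM0 : 0 < M := by
    rcases Nat.eq_zero_or_pos M with h | h
    · rw [h] at hMB; omega
    · exact h
  refine le_certainKnowledgeComplexity (M := M) (r := 2 * D) (q := D * Nat.clog 2 N) hκM hM0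
    (requires_of_two_pow_le (2 * D + 1) (h2.trans (Nat.le_succ _))) ?_ ?_
  · rw [mul_comm, pow_mul]
    exact Nat.pow_le_pow_left (Nat.le_pow_clog one_lt_two N) D
  · have hprod : κ * (κ + D * Nat.clog 2 N) ≤ B ^ 4 := by
      calc κ * (κ + D * Nat.clog 2 N) ≤ B * (B + B * B) := by
            gcongr <;> omega
        _ ≤ B * (B * B + B * B) := by gcongr; nlinarith
        _ = 2 * B ^ 3 := by ring
        _ ≤ B * B ^ 3 := by gcongr
        _ = B ^ 4 := by ring
    calc N ^ D * (κ * (κ + D * Nat.clog 2 N)) ^ (2 * D) ≤ N ^ D * (B ^ 4) ^ (2 * D) := by gcongr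
      _ = (N * (B ^ 4) ^ 2) ^ D := by rw [mul_pow, ← pow_mul _ 2 D]
      _ ≤ (M ^ 2) ^ D := by gcongr
      _ = M ^ (2 * D) := by rw [pow_mul]

lemma augmentedPathFamily_hard {k : ℕ → ℕ} (hk : IsAdmissible k) :
    (augmentedPathFamily k).HardForCertainKnowledge := by
  rintro ⟨p, hp⟩
  obtain ⟨n, hn⟩ := (augmentedPathFamily_certainKnowledge_gt hk p).exists
  exact absurd (hp n) (not_le.2 hn)

end LowerAsymptotics

end SwitchingNet

/-- First: families easy for certain-knowledge networks are easy for monotone ones. Then: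
functions `k(N) = 2 ^ Θ(√(lg N))` exist, and for each of them the family of all augmented paths of
length `k(N) + 1` (non-empty sets of inputs, with finite certain-knowledge complexity) is easy for
monotone switching networks but hard for certain-knowledge switching networks; indeed its
certain-knowledge complexity eventually exceeds every polynomial. -/
theorem mainTheorem3 :
    (∀ I : SwitchingNet.InputFamily, I.EasyForCertainKnowledge → I.EasyForMonotone) ∧
    (∃ k : ℕ → ℕ, SwitchingNet.IsAdmissible k) ∧
    ∀ k : ℕ → ℕ, SwitchingNet.IsAdmissible k →
      (∀ n, (SwitchingNet.augmentedPathFamily k n).Nonempty) ∧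
      (SwitchingNet.augmentedPathFamily k).EasyForMonotone ∧
      (SwitchingNet.augmentedPathFamily k).HardForCertainKnowledge ∧
      (∀ n, (SwitchingNet.augmentedPathFamily k).certainKnowledge n ≠ ⊤) ∧
      ∀ p : Polynomial ℕ, ∀ᶠ n in Filter.atTop,
        ((p.eval (n + 2) : ℕ) : ℕ∞) < (SwitchingNet.augmentedPathFamily k).certainKnowledge n := by
  refine ⟨fun I ⟨p, hp⟩ => ⟨p, fun n =>
      (SwitchingNet.monotoneComplexity_le_certainKnowledgeComplexity _ _ _).trans (hp n)⟩,
    SwitchingNet.exists_isAdmissible, fun k hk => ⟨SwitchingNet.augmentedPathFamily_nonempty hk,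
      SwitchingNet.augmentedPathFamily_easyForMonotone hk, SwitchingNet.augmentedPathFamily_hard hk,
      fun n => SwitchingNet.certainKnowledgeComplexity_ne_top (by simp [Fin.ext_iff]) _,
      SwitchingNet.augmentedPathFamily_certainKnowledge_gt hk⟩⟩
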